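/- Let $(X,\mu)$ be a $\sigma$-finite complete measure space for which $L^2(X)$ is separable, let $\mathcal H$ be a separable complex Hilbert space, let $(Y,\nu)$ be a $\sigma$-finite measure space, and let $I$ be a countable set. Let $\{g_t\}_{t\in Y}\subset L^\infty(X)$ be a Parseval determining set for $L^1(X)$: for every $f\in L^1(X)$ the function $t\mapsto\int_X f\,\overline{g_t}\,d\mu$ is measurable on $Y$ and $$\int_Y\Bigl|\int_X f\,\overline{g_t}\,d\mu\Bigr|^2 d\nu(t)=\int_X|f|^2\,d\mu$$ (both sides possibly infinite). For a sequence $\mathscr A=\{\varphi_i\}_{i\in I}$ in $L^2(X;\mathcal H)$ let $E(\mathscr A)=\{g_t\varphi_i\}_{(t,i)\in Y\times I}$, where $Y\times I$ carries the product of $\nu$ and counting measure, and let $S(\mathscr A)$ be the closed linear span of $E(\mathscr A)$ in $L^2(X;\mathcal H)$. $E(\mathscr A)$ is a frame for $S(\mathscr A)$ if there are $A,B>0$ such that, for all $v\in S(\mathscr A)$, the function $(t,i)\mapsto\langle v,g_t\varphi_i\rangle$ is measurable and $A\|v\|^2\le\sum_{i\in I}\int_Y|\langle v,g_t\varphi_i\rangle|^2\,d\nu(t)\le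 B\|v\|^2$; it is a Parseval frame if this holds with $A=B=1$. Two systems $E(\mathscr A)$, $E(\mathscr A')$ are unitarily equivalent if there is a unitary $U:S(\mathscr A)\to S(\mathscr A')$ with $U(g_t\varphi_i)=g_t\varphi_i'$ for all $t\in Y$, $i\in I$. The Gramian of a Bessel sequence $\{u_i\}_{i\in I}$ in $\mathcal H$ is $TT^*$ on $\ell^2(I)$, where $T:\mathcal H\to\ell^2(I)$, $Tv=(\langle v,u_i\rangle)_{i\in I}$. A multiplication-invariant (MI) operator on $L^2(X;\ell^2(I))$ is a bounded operator commuting with multiplication by every $\phi\in L^\infty(X)$. We write $\int_X^\oplus R(x)\,d\mu(x)$ for the operator $f\mapsto\bigl(x\mapsto R(x)f(x)\bigr)$ given by a weakly measurable, essentially bounded field $R(x)\in B(\ell^2(I))$. With $\{\delta_i\}_{i\in I}$ the canonical basis of $\ell^2(I)$, a positive MI operator $\int_X^\oplus R(x)\,d\mu(x)$ is integrable if $\int_X\langle R(x)\delta_i,\delta_i\rangle\,d\mu(x)<\infty$ for every $i\in I$. A positive operator $Q$ is locally invertible if $\sigma(Q)\subset\{0\}\cup[\delta,\infty)$ for some $\delta>0$.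 A range function $J:X\to\{\text{closed subspaces of }\ell^2(I)\}$, with $P_J(x)$ the orthogonal projection onto $J(x)$, is measurable if $P_J$ is weakly measurable, and a measurable $J$ is integrable if $\int_X\langle P_J(x)\delta_i,\delta_i\rangle\,d\mu(x)<\infty$ for every $i\in I$. Then: (1) Unitary equivalence classes of systems $E(\{\varphi_i\}_{i\in I})$ in $L^2(X;\mathcal H)$ that are frames for $S(\{\varphi_i\}_{i\in I})$ are in one-to-one correspondence with locally invertible, integrable MI operators $\int_X^\oplus \mathrm{Gr}(x)\,d\mu(x)$ on $L^2(X;\ell^2(I))$ having $\operatorname{rank}\mathrm{Gr}(x)\le\dim\mathcal H$ for a.e. $x\in X$. In this correspondence, $\mathrm{Gr}(x)$ is the Gramian of $\{\varphi_i(x)\}_{i\in I}$ for a.e. $x\in X$. (2) Unitary equivalence classes of systems $E(\{\varphi_i\}_{i\in I})$ in $L^2(X;\mathcal H)$ that are Parseval frames for $S(\{\varphi_i\}_{i\in I})$ are in one-to-one correspondence with integrable measurable range functions $J:X\to\{\text{closed subspaces of }\ell^2(I)\}$, identified when equal a.e., having $\dim J(x)\le\dim\mathcal H$ for a.e. $x\in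 X$. In this correspondence, the Gramian of $\{\varphi_i(x)\}_{i\in I}$ is the orthogonal projection onto $J(x)$ for a.e. $x\in X$. -/

import Mathlib

open MeasureTheory Filter
open scoped ENNReal ComplexConjugate

noncomputable section

namespace MultInv

section Frames

variable {M K K' : Type*} [MeasurableSpace M]
  [NormedAddCommGroup K] [InnerProductSpace ℂ K]
  [NormedAddCommGroup K'] [InnerProductSpace ℂ K']

/-- The system `{u s}`, indexed by the measure space `(M, m)`, is Bessel with bound `B`.
Mathlib's inner product is linear in the second variable, so `inner ℂ (u s) v` is what is
usually written `⟨v, u s⟩`. -/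
structure IsBessel (m : Measure M) (u : M → K) (B : ℝ) : Prop where
  measurable : ∀ v : K, Measurable fun s => inner ℂ (u s) v
  upper : ∀ v : K, ∫⁻ s, ‖inner ℂ (u s) v‖ₑ ^ 2 ∂m ≤ ENNReal.ofReal B * ‖v‖ₑ ^ 2

/-- The system `{u s}`, indexed by the measure space `(M, m)`, is a continuous frame for the whole
space `K` with bounds `A, B`. -/
structure IsFrame (m : Measure M) (u : M → K) (A B : ℝ) : Prop where
  lower_pos : 0 < A
  upper_pos : 0 < B
  bessel : IsBessel m u B
  lower : ∀ v : K, ENNReal.ofReal A * ‖v‖ₑ ^ 2 ≤ ∫⁻ s, ‖inner ℂ (u s) v‖ₑ ^ 2 ∂m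

/-- A Parseval frame. -/
def IsParsevalFrame (m : Measure M) (u : M → K) : Prop := IsFrame m u 1 1

/-- The closed linear span of a system of vectors. -/
def closedSpan {M K : Type*} [NormedAddCommGroup K] [InnerProductSpace ℂ K] (u : M → K) :
    Submodule ℂ K :=
  (Submodule.span ℂ (Set.range u)).topologicalClosure

theorem mem_closedSpan {M K : Type*} [NormedAddCommGroup K] [InnerProductSpace ℂ K]
    (u : M → K) (s : M) : u s ∈ closedSpan u :=
  Submodule.le_topologicalClosure _ (Submodule.subset_span ⟨s, rfl⟩)

/-- A system of vectors, regarded as a system in its closed linear span. -/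
def inClosedSpan {M K : Type*} [NormedAddCommGroup K] [InnerProductSpace ℂ K] (u : M → K) (s : M) :
    closedSpan u :=
  ⟨u s, mem_closedSpan u s⟩

/-- Unitary equivalence of systems of vectors with the same index set: there is a unitary between
the closed linear spans that maps `u s` to `u' s` for every `s`. -/
def UnitarilyEquivalent {M K K' : Type*} [NormedAddCommGroup K] [InnerProductSpace ℂ K]
    [NormedAddCommGroup K'] [InnerProductSpace ℂ K'] (u : M → K) (u' : M → K') : Prop :=
  ∃ U : closedSpan u ≃ₗᵢ[ℂ] closedSpan u', ∀ s, U (inClosedSpan u s) = inClosedSpan u' s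

end Frames

/-- The Hilbert space `ℓ²(I)`. -/
abbrev Ell2 (I : Type*) : Type _ := lp (fun _ : I => ℂ) 2

open Classical in
/-- The canonical basis vector `δ i` of `ℓ²(I)`. -/
def delta {I : Type*} (i : I) : Ell2 I := lp.single 2 i (1 : ℂ)

/-- `T` is the (bounded) analysis operator `v ↦ (⟨v, u i⟩)ᵢ` of the sequence `u`. -/
def IsAnalysisOperator {I K : Type*} [NormedAddCommGroup K] [InnerProductSpace ℂ K]
    (u : I → K) (T : K →L[ℂ] Ell2 I) : Prop :=
  ∀ (v : K) (i : I), (T v : I → ℂ) i = inner ℂ (u i) v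

/-- The sequence `u` is Bessel (it has a bounded analysis operator `T`) and `G = T T*` is its
Gramian. -/
def IsGramian {I K : Type*} [NormedAddCommGroup K] [InnerProductSpace ℂ K] [CompleteSpace K]
    (u : I → K) (G : Ell2 I →L[ℂ] Ell2 I) : Prop :=
  ∃ T : K →L[ℂ] Ell2 I, IsAnalysisOperator u T ∧ G = T ∘L ContinuousLinearMap.adjoint T

/-- The dimension of a complex vector space as an extended natural number. For a separable Hilbert
space this is its Hilbert dimension. -/
def dimension (K : Type*) [AddCommGroup K] [Module ℂ K] : ℕ∞ :=
  Cardinal.toENat (Module.rank ℂ K)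

section Multiplications

variable {X : Type*} [MeasurableSpace X] {μ : Measure X}
variable {H : Type*} [NormedAddCommGroup H] [InnerProductSpace ℂ H]

/-- The multiplication operator `M_a` of `L²(X; H)` with symbol `a ∈ L^∞(X)`. -/
def mulOp (a : Lp ℂ ∞ μ) (f : Lp H 2 μ) : Lp H 2 μ := a • f

/-- The family `{g t}`, `t ∈ Y`, in `L^∞(X)` is a Parseval determining set for `L¹(X)`. -/
structure IsParsevalDetermining {Y : Type*} [MeasurableSpace Y] (μ : Measure X) (ν : Measure Y)
    (g : Y → Lp ℂ ∞ μ) : Prop where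
  measurable : ∀ f : Lp ℂ 1 μ, Measurable fun t => ∫ x, f x * conj (g t x) ∂μ
  parseval : ∀ f : Lp ℂ 1 μ,
    ∫⁻ t, ‖∫ x, f x * conj (g t x) ∂μ‖ₑ ^ 2 ∂ν = ∫⁻ x, ‖f x‖ₑ ^ 2 ∂μ

/-- The system `E(φ) = {M_{g t} (φ i)}`, indexed by `(t, i) ∈ Y × I`. Its closed span is
`S(φ)`. -/
def multSystem {Y I : Type*} (g : Y → Lp ℂ ∞ μ) (φ : I → Lp H 2 μ) (p : Y × I) : Lp H 2 μ :=
  mulOp (g p.1) (φ p.2)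

/-- Sequences `φ` in `L²(X; H)`, up to unitary equivalence of the systems `E(φ)`. -/
def unitarySetoid {Y I : Type*} (g : Y → Lp ℂ ∞ μ) : Setoid (I → Lp H 2 μ) where
  r φ ψ := UnitarilyEquivalent (multSystem g φ) (multSystem g ψ)
  iseqv :=
    { refl := fun _ => ⟨LinearIsometryEquiv.refl ℂ _, fun _ => rfl⟩
      symm := fun ⟨U, hU⟩ => ⟨U.symm, fun s => by rw [← hU s, U.symm_apply_apply]⟩
      trans := fun ⟨U, hU⟩ ⟨V, hV⟩ =>
        ⟨U.trans V, fun s => by rw [LinearIsometryEquiv.trans_apply, hU s, hV s]⟩ }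

section Classes

variable {Y I : Type*} [MeasurableSpace Y] [MeasurableSpace I]

/-- The sequences `φ` in `L²(X; H)` for which `E(φ)` is a frame for `S(φ)`; the index set `Y × I`
carries the product of `ν` and the counting measure. -/
def FrameGenerators (H : Type*) [NormedAddCommGroup H] [InnerProductSpace ℂ H] (I : Type*)
    [MeasurableSpace I] (ν : Measure Y) (g : Y → Lp ℂ ∞ μ) : Type _ :=
  {φ : I → Lp H 2 μ //
    ∃ A B : ℝ, IsFrame (ν.prod Measure.count) (inClosedSpan (multSystem g φ)) A B}

/-- The sequences `φ` in `L²(X; H)` for which `E(φ)` is a Parseval frame for `S(φ)`. -/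
def ParsevalGenerators (H : Type*) [NormedAddCommGroup H] [InnerProductSpace ℂ H] (I : Type*)
    [MeasurableSpace I] (ν : Measure Y) (g : Y → Lp ℂ ∞ μ) : Type _ :=
  {φ : I → Lp H 2 μ //
    IsParsevalFrame (ν.prod Measure.count) (inClosedSpan (multSystem g φ))}

/-- Unitary equivalence of the systems `E(φ)` that are frames for `S(φ)`. -/
def frameSetoid (H : Type*) [NormedAddCommGroup H] [InnerProductSpace ℂ H] (I : Type*)
    [MeasurableSpace I] (ν : Measure Y) (g : Y → Lp ℂ ∞ μ) : Setoid (FrameGenerators H I ν g) :=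
  (unitarySetoid g).comap Subtype.val

/-- Unitary equivalence of the systems `E(φ)` that are Parseval frames for `S(φ)`. -/
def parsevalSetoid (H : Type*) [NormedAddCommGroup H] [InnerProductSpace ℂ H] (I : Type*)
    [MeasurableSpace I] (ν : Measure Y) (g : Y → Lp ℂ ∞ μ) :
    Setoid (ParsevalGenerators H I ν g) :=
  (unitarySetoid g).comap Subtype.val

end Classes

/-- `T` is a multiplication-invariant (MI) operator on `L²(X; K)`. -/
def IsMI {K : Type*} [NormedAddCommGroup K] [InnerProductSpace ℂ K]
    (T : Lp K 2 μ →L[ℂ] Lp K 2 μ) : Prop :=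
  ∀ (a : Lp ℂ ∞ μ) (f : Lp K 2 μ), T (mulOp a f) = mulOp a (T f)

/-- `R` is a bounded measurable range operator (field of operators on `K`) and
`T = ∫^⊕ R(x) dμ(x)` on `L²(X; K)`. -/
structure IsDirectIntegral {K : Type*} [NormedAddCommGroup K] [InnerProductSpace ℂ K]
    (R : X → K →L[ℂ] K) (T : Lp K 2 μ →L[ℂ] Lp K 2 μ) : Prop where
  measurable : ∀ u v : K, Measurable fun x => inner ℂ v (R x u)
  bounded : ∃ C : ℝ, ∀ᵐ x ∂μ, ‖R x‖ ≤ C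
  apply_ae : ∀ f : Lp K 2 μ, ∀ᵐ x ∂μ, T f x = R x (f x)

/-- A positive operator `T` with `σ(T) ⊆ {0} ∪ [δ, ∞)` for some `δ > 0`. -/
def IsLocallyInvertible {K : Type*} [NormedAddCommGroup K] [InnerProductSpace ℂ K]
    [CompleteSpace K] (T : K →L[ℂ] K) : Prop :=
  T.IsPositive ∧ ∃ δ : ℝ, 0 < δ ∧ spectrum ℂ T ⊆ {0} ∪ (fun r : ℝ => (r : ℂ)) '' Set.Ici δ

/-- The diagonal entries `⟨R(x) δ i, δ i⟩` of the field `R` are integrable. -/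
def IsIntegrableField {I : Type*} (μ : Measure X) (R : X → Ell2 I →L[ℂ] Ell2 I) : Prop :=
  ∀ i : I, Integrable (fun x => inner ℂ (delta i) (R x (delta i))) μ

/-- The locally invertible, integrable MI operators `∫^⊕ G(x) dμ(x)` on `L²(X; ℓ²(I))` with
`rank G(x) ≤ dim H` for almost every `x`. -/
def GramOperators (H : Type*) [NormedAddCommGroup H] [InnerProductSpace ℂ H] (I : Type*)
    (μ : Measure X) : Type _ :=
  {T : Lp (Ell2 I) 2 μ →L[ℂ] Lp (Ell2 I) 2 μ //
    IsMI T ∧ IsLocallyInvertible T ∧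
      ∃ R : X → Ell2 I →L[ℂ] Ell2 I, IsDirectIntegral R T ∧ IsIntegrableField μ R ∧
        ∀ᵐ x ∂μ, dimension (LinearMap.range (R x : Ell2 I →ₗ[ℂ] Ell2 I)) ≤ dimension H}

/-- The field of orthogonal projections onto the values of a range function. -/
def rangeProj {I : Type*} (J : X → ClosedSubmodule ℂ (Ell2 I)) (x : X) :
    Ell2 I →L[ℂ] Ell2 I :=
  (J x).toSubmodule.starProjection

/-- The range function `J` is measurable. -/
def IsMeasurableRange {I : Type*} (J : X → ClosedSubmodule ℂ (Ell2 I)) : Prop :=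
  ∀ u v : Ell2 I, Measurable fun x => inner ℂ v (rangeProj J x u)

/-- The integrable measurable range functions `J : X → {closed subspaces of ℓ²(I)}` with
`dim J(x) ≤ dim H` for almost every `x`. -/
def RangeFunctions (H : Type*) [NormedAddCommGroup H] [InnerProductSpace ℂ H] (I : Type*)
    (μ : Measure X) : Type _ :=
  {J : X → ClosedSubmodule ℂ (Ell2 I) //
    IsMeasurableRange J ∧ IsIntegrableField μ (rangeProj J) ∧
      ∀ᵐ x ∂μ, dimension (J x).toSubmodule ≤ dimension H}

/-- Range functions are identified when they agree almost everywhere. -/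
def rangeSetoid (H : Type*) [NormedAddCommGroup H] [InnerProductSpace ℂ H] (I : Type*)
    (μ : Measure X) : Setoid (RangeFunctions (X := X) H I μ) where
  r J J' := ∀ᵐ x ∂μ, J.1 x = J'.1 x
  iseqv :=
    { refl := fun _ => Eventually.of_forall fun _ => rfl
      symm := fun h => h.mono fun _ hx => hx.symm
      trans := fun h h' => (h.and h').mono fun _ hx => hx.1.trans hx.2 }

end Multiplications

end MultInv

end

open MeasureTheory Filter
open scoped ENNReal ComplexConjugate

noncomputable section

namespace MultInv

/-! ### Quotients by a relation, and unitary equivalence through Gram matrices -/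

section Pointwise

variable {M K K' : Type*} [NormedAddCommGroup K] [InnerProductSpace ℂ K]
  [NormedAddCommGroup K'] [InnerProductSpace ℂ K']

/-! Everything is read off the fibrewise analysis operator `T`, which sends `v` to the field of
sequences `⟨v(x), φ i (x)⟩`. Applying the determining identity to these L¹ functions shows that the
total energy of the frame coefficients of `v` is `‖T v‖²` (`lintegral_multSystem`), and that `ker T`
is the orthogonal complement of `S(φ)`. The operator `T T*` is the direct integral of the Gramians.
Hence a lower frame bound on `S(φ) = (ker T)ᗮ` is a spectral gap of `T T*` at zero, and the Parseval
condition says that `T T*`, equivalently almost every Gramian, is a projection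
(`IsFibreAnalysis.isFrame_iff`, `norm_sq_le_and_iff`).

The Gramian field is a complete invariant: unitary equivalence means equality of all `⟨g t φ i, g s
φ j⟩`, and using the determining property twice reduces this to equality of the fibrewise Gram
matrices.

Every admissible field occurs. The square root of a positive MI operator is again MI, so its columns
are measurable vectors of `ℓ²(I)` with the prescribed Gram matrix. Measurable Gram-Schmidt moves
them into `H`, where the rank condition leaves enough room (`exists_measurable_gram`); integrability
of the diagonal puts the result in `L²(X; H)` (`exists_realization`). -/

/-- Both bijections come from a relation "has this Gramian field": `h₃` gives well-definedness and
injectivity at once, `h₂` surjectivity. -/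
theorem exists_equiv_of_rel {α γ : Type*} (s : Setoid α) (Rel : α → γ → Prop)
    (h₁ : ∀ a, ∃ c, Rel a c) (h₂ : ∀ c, ∃ a, Rel a c)
    (h₃ : ∀ a a' c c', Rel a c → Rel a' c' → (s a a' ↔ c = c')) :
    ∃ F : Quotient s ≃ γ, ∀ a c, F (Quotient.mk _ a) = c ↔ Rel a c := by
  choose f hf using h₁
  let F : Quotient s → γ := Quotient.lift f fun a b hab => (h₃ a b _ _ (hf a) (hf b)).1 hab
  have hF : Function.Bijective F := by
    refine ⟨fun p q => ?_, fun c => ?_⟩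
    · induction p using Quotient.ind
      induction q using Quotient.ind
      exact fun h => Quotient.sound ((h₃ _ _ _ _ (hf _) (hf _)).2 h)
    · obtain ⟨a, ha⟩ := h₂ c
      exact ⟨Quotient.mk _ a, (h₃ a a _ _ (hf a) ha).1 (s.refl a)⟩
  refine ⟨Equiv.ofBijective F hF, fun a c => ⟨?_, fun h => (h₃ a a _ _ (hf a) h).1 (s.refl a)⟩⟩
  rintro rfl
  exact hf a

theorem denseRange_linearCombination (u : M → K) :
    DenseRange (Finsupp.linearCombination ℂ (inClosedSpan u)) := by
  intro v
  have hv : (v : K) ∈ closure (Submodule.span ℂ (Set.range u) : Set K) := v.2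
  rw [closure_subtype]
  refine closure_mono ?_ hv
  intro w hw
  rw [SetLike.mem_coe, Finsupp.mem_span_range_iff_exists_finsupp] at hw
  obtain ⟨c, rfl⟩ := hw
  refine ⟨Finsupp.linearCombination ℂ (inClosedSpan u) c, ⟨c, rfl⟩, ?_⟩
  simp [Finsupp.linearCombination_apply, Finsupp.sum, inClosedSpan]

/-- Systems with the same Gram matrix are unitarily equivalent, and conversely. -/
theorem unitarilyEquivalent_iff [CompleteSpace K] [CompleteSpace K'] (u : M → K) (u' : M → K') :
    UnitarilyEquivalent u u' ↔ ∀ s t, inner ℂ (u s) (u t) = inner ℂ (u' s) (u' t) := by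
  constructor
  · rintro ⟨U, hU⟩ s t
    have := U.inner_map_map (inClosedSpan u s) (inClosedSpan u t)
    rw [hU, hU] at this
    exact this.symm
  · intro h
    -- By sesquilinearity, equal Gram matrices make corresponding finite combinations equally long,
    -- so the correspondence extends to the closures.
    have hc : ∀ a b, inner ℂ (Finsupp.linearCombination ℂ (inClosedSpan u) a)
        (Finsupp.linearCombination ℂ (inClosedSpan u) b)
        = inner ℂ (Finsupp.linearCombination ℂ (inClosedSpan u') a)
          (Finsupp.linearCombination ℂ (inClosedSpan u') b) := by
      intro a b
      have h' : ∀ s t, inner ℂ (inClosedSpan u s) (inClosedSpan u t)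
        = inner ℂ (inClosedSpan u' s) (inClosedSpan u' t) := h
      simp only [Finsupp.linearCombination_apply, Finsupp.sum, sum_inner, inner_sum,
        inner_smul_left, inner_smul_right, h']
    have : CompleteSpace (closedSpan u) := (Submodule.isClosed_topologicalClosure _).completeSpace_coe
    have : CompleteSpace (closedSpan u') := (Submodule.isClosed_topologicalClosure _).completeSpace_coe
    refine ⟨(LinearEquiv.refl ℂ (M →₀ ℂ)).extendOfIsometry
      (Finsupp.linearCombination ℂ (inClosedSpan u))
      (Finsupp.linearCombination ℂ (inClosedSpan u'))
      (denseRange_linearCombination u) (denseRange_linearCombination u') fun a => ?_, fun s => ?_⟩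
    · rw [LinearEquiv.refl_apply, @norm_eq_sqrt_re_inner ℂ, @norm_eq_sqrt_re_inner ℂ, hc]
    · have := LinearEquiv.extendOfIsometry_eq (LinearEquiv.refl ℂ (M →₀ ℂ))
        (Finsupp.linearCombination ℂ (inClosedSpan u))
        (Finsupp.linearCombination ℂ (inClosedSpan u'))
        (denseRange_linearCombination u) (denseRange_linearCombination u')
        (fun a => by
          rw [LinearEquiv.refl_apply, @norm_eq_sqrt_re_inner ℂ, @norm_eq_sqrt_re_inner ℂ, hc])
        (Finsupp.single s 1)
      simpa using this

end Pointwise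

/-! ### Sequence spaces -/

section Ell2

variable {I K : Type*} [NormedAddCommGroup K] [InnerProductSpace ℂ K]

theorem inner_delta_left (i : I) (c : Ell2 I) : inner ℂ (delta i) c = c i := by
  classical
  simp only [delta]
  rw [lp.inner_single_left]
  simp

theorem delta_apply_self (i : I) : (delta i : Ell2 I) i = 1 := by
  simp [delta]

theorem delta_apply_of_ne {i j : I} (h : j ≠ i) : (delta i : Ell2 I) j = 0 := by
  simp [delta, h]

theorem orthonormal_delta : Orthonormal ℂ (delta : I → Ell2 I) := by
  classical
  refine orthonormal_iff_ite.2 fun i j => ?_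
  rw [inner_delta_left]
  split_ifs with h
  · rw [h, delta_apply_self]
  · rw [delta_apply_of_ne h]

theorem ext_delta {F : Type*} [NormedAddCommGroup F] [NormedSpace ℂ F] {R S : Ell2 I →L[ℂ] F}
    (h : ∀ i, R (delta i) = S (delta i)) : R = S := by
  classical
  refine lp.ext_continuousLinearMap (by simp) fun i => ?_
  ext
  have := h i
  simp only [delta] at this
  simpa using this

theorem ext_inner_delta {R S : Ell2 I →L[ℂ] Ell2 I}
    (h : ∀ i j, inner ℂ (delta i) (R (delta j)) = inner ℂ (delta i) (S (delta j))) : R = S := by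
  refine ext_delta fun j => ?_
  ext i
  rw [← inner_delta_left, h, inner_delta_left]

theorem separableSpace_ell2 [Countable I] : TopologicalSpace.SeparableSpace (Ell2 I) := by
  have h : (Submodule.span ℂ (Set.range (delta : I → Ell2 I))).topologicalClosure = ⊤ := by
    rw [Submodule.topologicalClosure_eq_top_iff, Submodule.eq_bot_iff]
    intro c hc
    ext i
    rw [← inner_delta_left]
    exact (Submodule.mem_orthogonal _ _).1 hc _ (Submodule.subset_span ⟨i, rfl⟩)
  have h' := (Set.countable_range (delta : I → Ell2 I)).isSeparable.span (R := ℂ) |>.closure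
  rw [← Submodule.topologicalClosure_coe, h] at h'
  exact TopologicalSpace.isSeparable_univ_iff.1 h'

/-- A sequence whose finite sections are uniformly Bessel has a bounded analysis operator. -/
theorem exists_analysis (u : I → K) (B : ℝ) (hB : 0 ≤ B)
    (h : ∀ (s : Finset I) (v : K), ∑ i ∈ s, ‖inner ℂ (u i) v‖ ^ 2 ≤ B * ‖v‖ ^ 2) :
    ∃ T : K →L[ℂ] Ell2 I, IsAnalysisOperator u T ∧ ‖T‖ ≤ Real.sqrt B := by
  have hmem : ∀ v : K, Memℓp (fun i => inner ℂ (u i) v) 2 := fun v =>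
    memℓp_gen' (C := B * ‖v‖ ^ 2) fun s => by simpa using h s v
  let T₀ : K →ₗ[ℂ] Ell2 I :=
    { toFun := fun v => ⟨fun i => inner ℂ (u i) v, hmem v⟩
      map_add' := fun v w => by ext i; exact inner_add_right _ _ _
      map_smul' := fun a v => by ext i; exact inner_smul_right _ _ _ }
  have hT₀ : ∀ v, ‖T₀ v‖ ≤ Real.sqrt B * ‖v‖ := fun v => by
    refine lp.norm_le_of_forall_sum_le (p := 2) (by norm_num) (by positivity) fun s => ?_
    have := h s v
    simp only [ENNReal.toReal_ofNat, Real.rpow_two]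
    rw [mul_pow, Real.sq_sqrt hB]
    exact this
  exact ⟨T₀.mkContinuous _ hT₀, fun v i => rfl, LinearMap.mkContinuous_norm_le _ (by positivity) _⟩

theorem IsAnalysisOperator.adjoint_delta [CompleteSpace K] {u : I → K} {T : K →L[ℂ] Ell2 I}
    (h : IsAnalysisOperator u T) (i : I) : ContinuousLinearMap.adjoint T (delta i) = u i := by
  refine ext_inner_right ℂ fun v => ?_
  rw [ContinuousLinearMap.adjoint_inner_left, inner_delta_left, h]

theorem IsGramian.inner_delta [CompleteSpace K] {u : I → K} {G : Ell2 I →L[ℂ] Ell2 I}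
    (h : IsGramian u G) (i j : I) :
    inner ℂ (delta i) (G (delta j)) = inner ℂ (u i) (u j) := by
  obtain ⟨T, hT, rfl⟩ := h
  rw [ContinuousLinearMap.comp_apply, hT.adjoint_delta, inner_delta_left, hT]

/-- Duality on finite sections: if `c` are the coefficients of `v`, `q` is their energy and `w = ∑ c
i • u i`, then `q = ⟨w, v⟩ ≤ ‖w‖ ‖v‖`, while `‖w‖² = ⟨a, G a⟩ ≤ ‖G‖ q`. Cancelling `q` leaves `q ≤
‖G‖ ‖v‖²`. -/
theorem exists_analysis_of_gram {u : I → K} {G : Ell2 I →L[ℂ] Ell2 I}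
    (h : ∀ i j, inner ℂ (delta i) (G (delta j)) = inner ℂ (u i) (u j)) :
    ∃ T : K →L[ℂ] Ell2 I, IsAnalysisOperator u T ∧ ‖T‖ ≤ Real.sqrt ‖G‖ := by
  refine exists_analysis u ‖G‖ (norm_nonneg _) fun s v => ?_
  set c : I → ℂ := fun i => inner ℂ (u i) v with hc
  set q := ∑ i ∈ s, ‖c i‖ ^ 2 with hq
  set a : Ell2 I := ∑ i ∈ s, c i • delta i with ha
  set w : K := ∑ i ∈ s, c i • u i with hw
  have hq0 : 0 ≤ q := Finset.sum_nonneg fun i _ => by positivity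
  have haa : ‖a‖ ^ 2 = q := by
    have : inner ℂ a a = (q : ℂ) := by
      rw [ha, orthonormal_delta.inner_sum, hq, Complex.ofReal_sum]
      exact Finset.sum_congr rfl fun i _ => by rw [RCLike.conj_mul]; simp
    rw [inner_self_eq_norm_sq_to_K] at this
    exact Complex.ofReal_injective (by simpa using this)
  have hww : ‖w‖ ^ 2 ≤ ‖G‖ * q := by
    have : inner ℂ w w = inner ℂ a (G a) := by
      simp only [hw, ha, map_sum, map_smul, sum_inner, inner_sum, inner_smul_left,
        inner_smul_right, h]
    have h1 : ‖w‖ ^ 2 = ‖inner ℂ a (G a)‖ := by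
      rw [← this, inner_self_eq_norm_sq_to_K]; simp
    rw [h1, ← haa]
    calc _ ≤ ‖a‖ * ‖G a‖ := norm_inner_le_norm _ _
      _ ≤ ‖a‖ * (‖G‖ * ‖a‖) := by gcongr; exact G.le_opNorm a
      _ = _ := by ring
  have hwv : q ≤ ‖w‖ * ‖v‖ := by
    have : inner ℂ w v = (q : ℂ) := by
      simp only [hw, hq, sum_inner, inner_smul_left, Complex.ofReal_sum, hc]
      exact Finset.sum_congr rfl fun i _ => by rw [RCLike.conj_mul]; simp
    calc q = ‖(q : ℂ)‖ := by simp [abs_of_nonneg hq0]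
      _ ≤ _ := this ▸ norm_inner_le_norm _ _
  have h2 : q ^ 2 ≤ (‖G‖ * q) * ‖v‖ ^ 2 := by
    calc q ^ 2 ≤ (‖w‖ * ‖v‖) ^ 2 := by gcongr
      _ = ‖w‖ ^ 2 * ‖v‖ ^ 2 := by ring
      _ ≤ _ := by gcongr
  rcases hq0.eq_or_lt with h0 | h0
  · rw [← h0]; positivity
  · refine le_of_mul_le_mul_left ?_ h0
    linarith [h2]

/-- A bounded operator with the right matrix entries already forces the sequence to be Bessel, so
only entries need checking. -/
theorem isGramian_iff [CompleteSpace K] {u : I → K} {G : Ell2 I →L[ℂ] Ell2 I} :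
    IsGramian u G ↔ ∀ i j, inner ℂ (delta i) (G (delta j)) = inner ℂ (u i) (u j) := by
  refine ⟨fun h => h.inner_delta, fun h => ?_⟩
  obtain ⟨T, hT, -⟩ := exists_analysis_of_gram h
  refine ⟨T, hT, ext_inner_delta fun i j => ?_⟩
  rw [h, IsGramian.inner_delta ⟨T, hT, rfl⟩]

end Ell2

/-! ### Operators with a spectral gap at zero -/

section Gap

variable {K L : Type*} [NormedAddCommGroup K] [InnerProductSpace ℂ K]
  [NormedAddCommGroup L] [InnerProductSpace ℂ L]

/-- Both sides say `T² ≥ δ T`: by functional calculus this means `t² ≥ δ t` on the spectrum, and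
since `t ≥ 0` there, `t = 0` or `t ≥ δ`. -/
theorem spectrum_subset_iff [CompleteSpace K] {T : K →L[ℂ] K} (hT : T.IsPositive) {δ : ℝ} (hδ : 0 < δ) :
    spectrum ℂ T ⊆ {0} ∪ (fun r : ℝ => (r : ℂ)) '' Set.Ici δ ↔
      ∀ f, δ * (inner ℂ (T f) f).re ≤ ‖T f‖ ^ 2 := by
  have hsa : IsSelfAdjoint T := hT.isSelfAdjoint
  have h0 : 0 ≤ T := ContinuousLinearMap.nonneg_iff_isPositive T |>.2 hT
  have h1 : (∀ f, δ * (inner ℂ (T f) f).re ≤ ‖T f‖ ^ 2) ↔ 0 ≤ T * T - δ • T := by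
    rw [ContinuousLinearMap.nonneg_iff_isPositive, ContinuousLinearMap.isPositive_def']
    have h3 : IsSelfAdjoint (T * T - δ • T) := by
      refine IsSelfAdjoint.sub ?_ ((IsSelfAdjoint.all δ).smul hsa)
      rw [← pow_two]; exact hsa.pow 2
    simp only [h3, true_and]
    refine forall_congr' fun f => ?_
    have h4 : inner ℂ ((T * T) f) f = (‖T f‖ : ℂ) ^ 2 := by
      rw [_root_.mul_apply_eq_comp, hT.inner_left_eq_inner_right,
        inner_self_eq_norm_sq_to_K]
      simp
    have h5 : (T * T - δ • T).reApplyInnerSelf f = ‖T f‖ ^ 2 - δ * (inner ℂ (T f) f).re := by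
      rw [ContinuousLinearMap.reApplyInnerSelf, _root_.sub_apply, inner_sub_left, h4,
        _root_.smul_apply, ← Complex.coe_smul, inner_smul_left]
      simp [← Complex.ofReal_pow]
    rw [h5, sub_nonneg]
  have h2 : T * T - δ • T = cfc (fun t : ℝ => t * t - δ * t) T := by
    rw [cfc_sub .., cfc_mul .., cfc_const_mul .., cfc_id' ℝ T]
  rw [h1, h2, cfc_nonneg_iff _ T]
  have hmem : ∀ x : ℝ, (x : ℂ) ∈ spectrum ℂ T ↔ x ∈ spectrum ℝ T := fun x =>
    spectrum.algebraMap_mem_iff (R := ℝ) ℂ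
  have hnn : ∀ x ∈ spectrum ℝ T, 0 ≤ x := fun x hx => spectrum_nonneg_of_nonneg h0 hx
  constructor
  · intro h x hx
    rcases h ((hmem x).2 hx) with h6 | ⟨r, hr, h6⟩
    · have : x = 0 := by simpa using h6
      simp [this]
    · have : r = x := Complex.ofReal_injective h6
      subst this
      nlinarith [hnn _ hx, Set.mem_Ici.1 hr]
  · intro h z hz
    have h7 : z = ((z.re : ℝ) : ℂ) := hsa.mem_spectrum_eq_re hz
    have h8 : z.re ∈ spectrum ℝ T := by rw [← hmem, ← h7]; exact hz
    rcases (hnn _ h8).eq_or_lt with h9 | h9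
    · left
      rw [Set.mem_singleton_iff, h7, ← h9]; simp
    · right
      refine ⟨z.re, ?_, h7.symm⟩
      have := h _ h8
      by_contra h10
      rw [Set.mem_Ici, not_le] at h10
      nlinarith

variable (T : K →L[ℂ] L)

/-- An operator is bounded below on the orthogonal complement of its kernel iff it is bounded below
on the range of its adjoint. -/
theorem forall_orthogonal_ker_iff [CompleteSpace K] [CompleteSpace L] {S : Submodule ℂ K} [CompleteSpace S]
    (hS : ∀ v, v ∈ Sᗮ ↔ T v = 0) (δ : ℝ) :
    (∀ v ∈ S, δ * ‖v‖ ^ 2 ≤ ‖T v‖ ^ 2) ↔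
      ∀ f, δ * (inner ℂ ((T ∘L ContinuousLinearMap.adjoint T) f) f).re
        ≤ ‖(T ∘L ContinuousLinearMap.adjoint T) f‖ ^ 2 := by
  have key : ∀ f, (inner ℂ ((T ∘L ContinuousLinearMap.adjoint T) f) f).re
      = ‖ContinuousLinearMap.adjoint T f‖ ^ 2 := fun f => by
    rw [ContinuousLinearMap.comp_apply, ← ContinuousLinearMap.adjoint_inner_right,
      inner_self_eq_norm_sq_to_K]
    simp [← Complex.ofReal_pow]
  simp only [key]
  have hmem : ∀ f, ContinuousLinearMap.adjoint T f ∈ S := fun f => by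
    rw [← Submodule.orthogonal_orthogonal S, Submodule.mem_orthogonal]
    intro u hu
    rw [ContinuousLinearMap.adjoint_inner_right, (hS u).1 hu, inner_zero_left]
  refine ⟨fun h f => h _ (hmem f), fun h v hv => ?_⟩
  -- The complement of `ran T*` is `ker T = Sᗮ`, so `ran T*` is dense in `S` and the closed
  -- inequality need only be tested on it.
  have hle : S ≤ (LinearMap.range (ContinuousLinearMap.adjoint T).toLinearMap).topologicalClosure := by
    rw [← Submodule.orthogonal_orthogonal_eq_closure]
    have : (LinearMap.range (ContinuousLinearMap.adjoint T).toLinearMap)ᗮ ≤ Sᗮ := fun w hw => by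
      rw [hS]
      refine ext_inner_left ℂ fun f => ?_
      rw [inner_zero_right, ← ContinuousLinearMap.adjoint_inner_left]
      exact (Submodule.mem_orthogonal _ _).1 hw _ ⟨f, rfl⟩
    exact (Submodule.le_orthogonal_orthogonal S).trans (Submodule.orthogonal_le this)
  have hcl : IsClosed {v : K | δ * ‖v‖ ^ 2 ≤ ‖T v‖ ^ 2} :=
    isClosed_le (by fun_prop) (by fun_prop)
  refine closure_minimal ?_ hcl (hle hv)
  rintro _ ⟨f, rfl⟩
  exact h f

/-- The upper frame bound is only given on `S`, but `T` factors through the projection onto `S`. -/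
theorem norm_sq_le_of_orthogonal {S : Submodule ℂ K} [CompleteSpace S] {B : ℝ}
    (hS : ∀ v ∈ Sᗮ, T v = 0) (h : ∀ v ∈ S, ‖T v‖ ^ 2 ≤ B * ‖v‖ ^ 2) (hB : 0 ≤ B) (v : K) :
    ‖T v‖ ^ 2 ≤ B * ‖v‖ ^ 2 := by
  have h1 : T v = T (S.starProjection v) := by
    have := hS _ (S.sub_starProjection_mem_orthogonal v)
    rwa [map_sub, sub_eq_zero] at this
  rw [h1]
  refine (h _ (S.starProjection_apply_mem v)).trans ?_
  gcongr
  exact S.norm_starProjection_apply_le v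

/-- A positive operator `T` with `⟨T f, f⟩ = ‖T f‖²` for all `f` is idempotent. -/
theorem mul_self_eq_of_norm_sq {T : K →L[ℂ] K} (hT : T.IsPositive)
    (h : ∀ f, (inner ℂ (T f) f).re = ‖T f‖ ^ 2) : T * T = T := by
  have : (T * T : K →L[ℂ] K).toLinearMap = T.toLinearMap := by
    -- Over `ℂ`, polarization recovers an operator from its quadratic form.
    rw [← ext_inner_map]
    intro f
    have h1 : inner ℂ ((T * T) f) f = (‖T f‖ : ℂ) ^ 2 := by
      rw [_root_.mul_apply_eq_comp, hT.inner_left_eq_inner_right,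
        inner_self_eq_norm_sq_to_K]
      simp
    have h2 := hT.inner_nonneg_left f
    refine h1.trans ?_
    rw [← Complex.ofReal_pow, ← h f]
    exact (Complex.eq_re_of_ofReal_le (by exact_mod_cast h2)).symm
  ext f
  exact congrArg (fun S => S f) this

/-- The commutation clause, inherited through functional calculus, is what keeps the root of an MI
operator multiplication-invariant. -/
theorem exists_sqrt [CompleteSpace K] {T : K →L[ℂ] K} (hT : T.IsPositive) :
    ∃ S : K →L[ℂ] K, IsSelfAdjoint S ∧ S * S = T ∧ ∀ M, Commute T M → Commute S M := by
  have h0 : 0 ≤ T := (ContinuousLinearMap.nonneg_iff_isPositive T).2 hT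
  refine ⟨CFC.sqrt T, (CFC.sqrt_nonneg T).isSelfAdjoint, CFC.sqrt_mul_sqrt_self T h0,
    fun M hM => ?_⟩
  rw [CFC.sqrt_eq_cfc]
  exact hM.cfc_nnreal _

end Gap

/-! ### Measurable realization of Gram matrices -/

section GramSchmidt

theorem exists_orthonormal_seq (H : Type*) [NormedAddCommGroup H] [InnerProductSpace ℂ H] :
    ∃ h : ℕ → H, ∀ k l : ℕ, (k : ℕ∞) < dimension H → (l : ℕ∞) < dimension H →
      inner ℂ (h k) (h l) = if k = l then (1 : ℂ) else 0 := by
  by_cases hf : FiniteDimensional ℂ H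
  · have hd : dimension H = Module.finrank ℂ H := by
      rw [dimension, ← Module.finrank_eq_rank, Cardinal.toENat_nat]
    -- Zero past the dimension is a dummy value; orthonormality is claimed only for indices below
    -- it.
    refine ⟨fun k => if hk : k < Module.finrank ℂ H then stdOrthonormalBasis ℂ H ⟨k, hk⟩ else 0,
      fun k l hk hl => ?_⟩
    rw [hd, Nat.cast_lt] at hk hl
    simp only [hk, hl, dif_pos]
    rw [orthonormal_iff_ite.1 (stdOrthonormalBasis ℂ H).orthonormal]
    simp
  · let b := Module.Basis.ofVectorSpace ℂ H
    have : Infinite (Module.Basis.ofVectorSpaceIndex ℂ H) := by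
      by_contra hn
      rw [not_infinite_iff_finite] at hn
      exact hf (Module.Finite.of_basis b)
    let e := Infinite.natEmbedding (Module.Basis.ofVectorSpaceIndex ℂ H)
    have hli : LinearIndependent ℂ (b ∘ e) := b.linearIndependent.comp _ e.injective
    refine ⟨InnerProductSpace.gramSchmidtNormed ℂ (b ∘ e), fun k l _ _ => ?_⟩
    exact orthonormal_iff_ite.1 (InnerProductSpace.gramSchmidtNormed_orthonormal hli) k l

theorem card_le_dimension {ι E : Type*} [NormedAddCommGroup E] [InnerProductSpace ℂ E]
    (W : Submodule ℂ E) (v : ι → E) (s : Finset ι) (hv : ∀ i ∈ s, v i ∈ W)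
    (h0 : ∀ i ∈ s, v i ≠ 0) (ho : ∀ i ∈ s, ∀ j ∈ s, i ≠ j → inner ℂ (v i) (v j) = 0) :
    (s.card : ℕ∞) ≤ dimension W := by
  let v' : s → W := fun i => ⟨v i, hv i i.2⟩
  have hli : LinearIndependent ℂ v' := by
    refine linearIndependent_of_ne_zero_of_inner_eq_zero (fun i h => h0 i i.2 ?_)
      fun i j hij => ho i i.2 j j.2 fun h => hij (Subtype.ext h)
    exact congrArg Subtype.val h
  have h1 := hli.cardinal_lift_le_rank
  have h2 := OrderHomClass.mono Cardinal.toENat h1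
  simpa [dimension] using h2

variable {X E H : Type*} [MeasurableSpace X] [NormedAddCommGroup E] [InnerProductSpace ℂ E]
  [NormedAddCommGroup H] [InnerProductSpace ℂ H]

theorem stronglyMeasurable_gramSchmidt {w : ℕ → X → E} (hw : ∀ n, StronglyMeasurable (w n))
    (n : ℕ) : StronglyMeasurable
      fun x => InnerProductSpace.gramSchmidt ℂ (fun k => w k x) n := by
  induction n using Nat.strong_induction_on with
  | _ n ih =>
    have : (fun x => InnerProductSpace.gramSchmidt ℂ (fun k => w k x) n) = fun x =>
        w n x - ∑ i ∈ Finset.Iio n,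
          (inner ℂ (InnerProductSpace.gramSchmidt ℂ (fun k => w k x) i) (w n x) /
            (‖InnerProductSpace.gramSchmidt ℂ (fun k => w k x) i‖ : ℂ) ^ 2) •
              InnerProductSpace.gramSchmidt ℂ (fun k => w k x) i := by
      funext x
      rw [eq_sub_iff_add_eq]
      exact (InnerProductSpace.gramSchmidt_def'' ℂ (fun k => w k x) n).symm
    rw [this]
    refine (hw n).sub (Finset.stronglyMeasurable_fun_sum _ fun i hi => ?_)
    have hi' := ih i (Finset.mem_Iio.1 hi)
    refine StronglyMeasurable.smul (Measurable.stronglyMeasurable ?_) hi'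
    exact (hi'.inner (hw n)).measurable.div
      ((Complex.measurable_ofReal.comp hi'.norm.measurable).pow_const 2)

/-- Write `w n` as a combination of unnormalized Gram-Schmidt vectors `g i`, then replace each
nonzero `g i` by a vector of equal length along its own member of a fixed orthonormal sequence in
`H`. Keeping the coefficients keeps the inner products. -/
theorem exists_measurable_gram {w : ℕ → X → E} (hw : ∀ n, StronglyMeasurable (w n)) :
    ∃ φ : ℕ → X → H, (∀ n, StronglyMeasurable (φ n)) ∧ ∀ x,
      dimension (Submodule.span ℂ (Set.range fun n => w n x)) ≤ dimension H →
        ∀ m n, inner ℂ (φ m x) (φ n x) = inner ℂ (w m x) (w n x) := by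
  classical
  obtain ⟨h, hh⟩ := exists_orthonormal_seq H
  let g : ℕ → X → E := fun n x => InnerProductSpace.gramSchmidt ℂ (fun k => w k x) n
  have hg : ∀ n, StronglyMeasurable (g n) := stronglyMeasurable_gramSchmidt hw
  -- Counting only earlier nonzero vectors gives them consecutive indices, so no dimension of `H` is
  -- wasted.
  let k : ℕ → X → ℕ := fun n x => ((Finset.range n).filter fun j => g j x ≠ 0).card
  have hk : ∀ n, Measurable (k n) := by
    intro n
    have : k n = fun x => ∑ j ∈ Finset.range n, if ‖g j x‖ ≠ 0 then 1 else 0 := by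
      funext x
      simp only [k, Finset.card_filter, norm_ne_zero_iff]
    rw [this]
    refine Finset.measurable_fun_sum _ fun j _ => Measurable.ite ?_ measurable_const measurable_const
    exact (hg j).norm.measurable (measurableSet_singleton 0).compl
  let G : ℕ → X → H := fun n x => (‖g n x‖ : ℂ) • h (k n x)
  have hG : ∀ n, StronglyMeasurable (G n) := fun n =>
    (Complex.continuous_ofReal.comp_stronglyMeasurable (hg n).norm).smul
      (StronglyMeasurable.of_discrete.comp_measurable (hk n))
  let a : ℕ → ℕ → X → ℂ := fun n i x =>
    if i = n then 1 else inner ℂ (g i x) (w n x) / (‖g i x‖ : ℂ) ^ 2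
  have ha : ∀ n i, StronglyMeasurable (a n i) := by
    intro n i
    by_cases h : i = n
    · simpa only [a, h, if_true] using stronglyMeasurable_const
    · simp only [a, h, if_false]
      exact (((hg i).inner (hw n)).measurable.div
        ((Complex.measurable_ofReal.comp (hg i).norm.measurable).pow_const 2)).stronglyMeasurable
  have hwx : ∀ n x, w n x = ∑ i ∈ Finset.Iic n, a n i x • g i x := by
    intro n x
    rw [← Finset.Iio_insert, Finset.sum_insert (by simp)]
    simp only [a, if_true, one_smul]
    refine (InnerProductSpace.gramSchmidt_def'' ℂ (fun k => w k x) n).trans ?_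
    refine congrArg _ (Finset.sum_congr rfl fun i hi => ?_)
    rw [if_neg (Finset.mem_Iio.1 hi).ne]
    rfl
  refine ⟨fun n x => ∑ i ∈ Finset.Iic n, a n i x • G i x, fun n =>
    Finset.stronglyMeasurable_fun_sum _ fun i _ => (ha n i).smul (hG i), fun x hx m n => ?_⟩
  have horth : ∀ i j, i ≠ j → inner ℂ (g i x) (g j x) = 0 := fun i j hij =>
    InnerProductSpace.gramSchmidt_orthogonal ℂ _ hij
  -- `g n x` and its `k n x` nonzero predecessors are orthogonal in the span, whence the strict
  -- inequality.
  have hlt : ∀ n, g n x ≠ 0 → (k n x : ℕ∞) < dimension H := by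
    intro n hn
    refine lt_of_lt_of_le ?_ hx
    have := card_le_dimension (Submodule.span ℂ (Set.range fun n => w n x)) (fun j => g j x)
      ((Finset.range (n + 1)).filter fun j => g j x ≠ 0) (fun i _ => ?_)
      (fun i hi => (Finset.mem_filter.1 hi).2) (fun i _ j _ => horth i j)
    · refine lt_of_lt_of_le ?_ this
      rw [Finset.range_add_one, Finset.filter_insert, if_pos hn, Finset.card_insert_of_notMem (by simp)]
      exact_mod_cast Nat.lt_succ_self _
    · rw [← InnerProductSpace.span_gramSchmidt ℂ]
      exact Submodule.subset_span ⟨i, rfl⟩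
  have hmono : ∀ i j, i < j → g i x ≠ 0 → k i x < k j x := by
    intro i j hij hi
    refine Finset.card_lt_card ⟨fun l hl => ?_, fun hsub => ?_⟩
    · simp only [Finset.mem_filter, Finset.mem_range] at hl ⊢
      exact ⟨hl.1.trans hij, hl.2⟩
    · have := hsub (Finset.mem_filter.2 ⟨Finset.mem_range.2 hij, hi⟩)
      simp at this
  have hGg : ∀ i j, inner ℂ (G i x) (G j x) = inner ℂ (g i x) (g j x) := by
    intro i j
    simp only [G, inner_smul_left, inner_smul_right]
    by_cases hi : g i x = 0
    · simp [hi]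
    by_cases hj : g j x = 0
    · simp [hj]
    rw [hh _ _ (hlt i hi) (hlt j hj)]
    by_cases hij : i = j
    · subst hij
      rw [if_pos rfl, inner_self_eq_norm_sq_to_K]
      simp [pow_two]
    · rw [horth i j hij, if_neg]
      · simp
      · rcases lt_or_gt_of_ne hij with h1 | h1
        · exact (hmono i j h1 hi).ne
        · exact (hmono j i h1 hj).ne'
  simp only [hwx, sum_inner, inner_sum, inner_smul_left, inner_smul_right, hGg]

end GramSchmidt

/-! ### Direct integrals of operator fields -/

section DirectIntegral

variable {X E F : Type*} [MeasurableSpace X] {μ : Measure X}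
  [NormedAddCommGroup E] [InnerProductSpace ℂ E] [NormedAddCommGroup F] [InnerProductSpace ℂ F]

/-- A weakly measurable function with values in a separable Hilbert space is strongly measurable. -/
theorem stronglyMeasurable_of_inner [CompleteSpace E] [TopologicalSpace.SeparableSpace E]
    {f : X → E} (hf : ∀ v : E, Measurable fun x => inner ℂ v (f x)) : StronglyMeasurable f := by
  let V : ℕ → Submodule ℂ E := fun n =>
    Submodule.span ℂ (TopologicalSpace.denseSeq E '' (Finset.range n : Set ℕ))
  have hfin : ∀ n, FiniteDimensional ℂ (V n) := fun n =>
    FiniteDimensional.span_of_finite ℂ ((Finset.finite_toSet _).image _)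
  have hmono : Monotone V := fun m n hmn => Submodule.span_mono (Set.image_mono (by
    exact_mod_cast Finset.range_mono hmn))
  have hdense : ⊤ ≤ (⨆ n, V n).topologicalClosure := by
    intro v _
    refine closure_mono ?_ (TopologicalSpace.denseRange_denseSeq E v)
    rintro _ ⟨n, rfl⟩
    exact Submodule.mem_iSup_of_mem (n + 1) (Submodule.subset_span ⟨n, by simp, rfl⟩)
  -- `f` is the pointwise limit of its projections onto finite-dimensional spaces, whose coordinates
  -- are measurable by hypothesis.
  refine stronglyMeasurable_of_tendsto (f := fun n x => (V n).starProjection (f x)) atTop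
    (fun n => ?_) (tendsto_pi_nhds.2 fun x =>
      Submodule.starProjection_tendsto_self (𝕜 := ℂ) (U := V) hmono (f x) hdense)
  have : (fun x => (V n).starProjection (f x)) = fun x =>
      ∑ i, inner ℂ (stdOrthonormalBasis ℂ (V n) i : E) (f x) •
        (stdOrthonormalBasis ℂ (V n) i : E) := by
    funext x
    exact (stdOrthonormalBasis ℂ (V n)).starProjection_eq_sum_rankOne ▸ by simp
  rw [this]
  exact Finset.stronglyMeasurable_fun_sum _ fun i _ =>
    (hf _).stronglyMeasurable.smul stronglyMeasurable_const

/-- For simple `f` this is a finite sum of columns `R x y` cut off to measurable sets; continuity of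
each `R x` handles the limit. -/
theorem stronglyMeasurable_field_apply [CompleteSpace F] [TopologicalSpace.SeparableSpace F]
    {R : X → E →L[ℂ] F} (hR : ∀ u v, Measurable fun x => inner ℂ v (R x u)) {f : X → E}
    (hf : StronglyMeasurable f) : StronglyMeasurable fun x => R x (f x) := by
  have hc : ∀ u, StronglyMeasurable fun x => R x u := fun u => stronglyMeasurable_of_inner (hR u)
  refine stronglyMeasurable_of_tendsto (f := fun n x => R x (hf.approx n x)) atTop (fun n => ?_)
    (tendsto_pi_nhds.2 fun x => ((R x).continuous.tendsto _).comp (hf.tendsto_approx x))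
  generalize hf.approx n = s
  have : (fun x => R x (s x)) = fun x => ∑ y ∈ s.range, (s ⁻¹' {y}).indicator (fun x => R x y) x := by
    funext x
    rw [Finset.sum_eq_single (s x)]
    · simp
    · intro y _ hy
      exact Set.indicator_of_notMem (fun h => hy h.symm) _
    · simp
  rw [this]
  exact Finset.stronglyMeasurable_fun_sum _ fun y _ =>
    (hc y).indicator (s.measurableSet_fiber y)

theorem exists_directIntegral [CompleteSpace F] [TopologicalSpace.SeparableSpace F]
    {R : X → E →L[ℂ] F} (hR : ∀ u v, Measurable fun x => inner ℂ v (R x u))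
    (hb : ∃ C : ℝ, ∀ᵐ x ∂μ, ‖R x‖ ≤ C) :
    ∃ T : Lp E 2 μ →L[ℂ] Lp F 2 μ, ∀ f : Lp E 2 μ, ∀ᵐ x ∂μ, T f x = R x (f x) := by
  obtain ⟨C, hC⟩ := hb
  have hle : ∀ f : Lp E 2 μ, ∀ᵐ x ∂μ, ‖R x (f x)‖ ≤ C * ‖f x‖ := fun f =>
    hC.mono fun x hx => (R x).le_of_opNorm_le hx _
  have hmem : ∀ f : Lp E 2 μ, MemLp (fun x => R x (f x)) 2 μ := fun f =>
    (Lp.memLp f).of_le_mul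
      (stronglyMeasurable_field_apply hR (Lp.stronglyMeasurable f)).aestronglyMeasurable (hle f)
  let T₀ : Lp E 2 μ →ₗ[ℂ] Lp F 2 μ :=
    { toFun := fun f => (hmem f).toLp
      map_add' := fun f g => by
        refine Lp.ext ?_
        filter_upwards [(hmem (f + g)).coeFn_toLp, (hmem f).coeFn_toLp, (hmem g).coeFn_toLp,
          Lp.coeFn_add f g, Lp.coeFn_add (hmem f).toLp (hmem g).toLp] with x h1 h2 h3 h4 h5
        rw [h1, h5, h4, Pi.add_apply, Pi.add_apply, map_add, h2, h3]
      map_smul' := fun c f => by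
        refine Lp.ext ?_
        filter_upwards [(hmem (c • f)).coeFn_toLp, (hmem f).coeFn_toLp,
          Lp.coeFn_smul c f, Lp.coeFn_smul c (hmem f).toLp] with x h1 h2 h3 h4
        rw [h1, RingHom.id_apply, h4, h3, Pi.smul_apply, Pi.smul_apply, map_smul, h2] }
  refine ⟨T₀.mkContinuous C fun f => Lp.norm_le_mul_norm_of_ae_le_mul ?_, fun f =>
    (hmem f).coeFn_toLp⟩
  filter_upwards [hle f, (hmem f).coeFn_toLp] with x h1 h2
  exact h2 ▸ h1

theorem adjoint_directIntegral [CompleteSpace E] [CompleteSpace F] {R : X → E →L[ℂ] F}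
    {T : Lp E 2 μ →L[ℂ] Lp F 2 μ} {T' : Lp F 2 μ →L[ℂ] Lp E 2 μ}
    (hT : ∀ f : Lp E 2 μ, ∀ᵐ x ∂μ, T f x = R x (f x))
    (hT' : ∀ f : Lp F 2 μ, ∀ᵐ x ∂μ, T' f x = ContinuousLinearMap.adjoint (R x) (f x)) :
    T' = ContinuousLinearMap.adjoint T := by
  rw [ContinuousLinearMap.eq_adjoint_iff]
  intro f v
  rw [L2.inner_def, L2.inner_def]
  refine integral_congr_ae ?_
  filter_upwards [hT v, hT' f] with x h1 h2
  rw [h1, h2, ContinuousLinearMap.adjoint_inner_left]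

/-- Constant fields need not be square integrable; a strictly positive weight makes them so and can
be divided out pointwise. -/
theorem exists_weight (μ : Measure X) [SigmaFinite μ] :
    ∃ η : X → ℝ, Measurable η ∧ (∀ x, 0 < η x) ∧ MemLp η 2 μ := by
  obtain ⟨g, hg0, hgm, hg⟩ := exists_pos_lintegral_lt_of_sigmaFinite μ (one_ne_zero (α := ℝ≥0∞))
  have hm : Measurable fun x => Real.sqrt (g x) := hgm.coe_nnreal_real.sqrt
  refine ⟨fun x => Real.sqrt (g x), hm, fun x => Real.sqrt_pos.2 (hg0 x), ?_⟩
  rw [memLp_two_iff_integrable_sq hm.aestronglyMeasurable]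
  have : (fun x => Real.sqrt (g x) ^ 2) = fun x => (g x : ℝ) :=
    funext fun x => Real.sq_sqrt (g x).2
  rw [this]
  refine ⟨hgm.coe_nnreal_real.aestronglyMeasurable, ?_⟩
  rw [HasFiniteIntegral]
  simpa using hg.trans ENNReal.one_lt_top

theorem memLp_weight_smul {η : X → ℝ} (hη : MemLp η 2 μ) (v : E) :
    MemLp (fun x => (η x : ℂ) • v) 2 μ := by
  refine hη.of_le_mul (c := ‖v‖) ?_ (Eventually.of_forall fun x => ?_)
  · exact (Complex.continuous_ofReal.comp_aestronglyMeasurable hη.1).smul_const v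
  · rw [norm_smul, Complex.norm_real, mul_comm]

theorem ae_eq_of_directIntegral {I : Type*} [Countable I] [SigmaFinite μ]
    {R R' : X → Ell2 I →L[ℂ] F} {T : Lp (Ell2 I) 2 μ →L[ℂ] Lp F 2 μ}
    (h : ∀ f : Lp (Ell2 I) 2 μ, ∀ᵐ x ∂μ, T f x = R x (f x))
    (h' : ∀ f : Lp (Ell2 I) 2 μ, ∀ᵐ x ∂μ, T f x = R' x (f x)) : ∀ᵐ x ∂μ, R x = R' x := by
  obtain ⟨η, -, hpos, hη⟩ := exists_weight μ
  have key : ∀ i : I, ∀ᵐ x ∂μ, R x (delta i) = R' x (delta i) := fun i => by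
    let f : Lp (Ell2 I) 2 μ := (memLp_weight_smul hη (delta i)).toLp
    filter_upwards [h f, h' f, (memLp_weight_smul hη (delta i)).coeFn_toLp] with x h1 h2 h3
    rw [h1, h3, map_smul, map_smul] at h2
    exact smul_right_injective _ (Complex.ofReal_ne_zero.2 (hpos x).ne') h2
  filter_upwards [ae_all_iff.2 key] with x hx
  exact ext_delta hx

theorem IsDirectIntegral.isMI {R : X → E →L[ℂ] E} {T : Lp E 2 μ →L[ℂ] Lp E 2 μ}
    (h : IsDirectIntegral R T) : IsMI T := by
  intro a f
  refine Lp.ext ?_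
  filter_upwards [h.apply_ae (mulOp a f), h.apply_ae f, Lp.coeFn_lpSMul (r := 2) a f,
    Lp.coeFn_lpSMul (r := 2) a (T f)] with x h1 h2 h3 h4
  have h3' : mulOp a f x = a x • f x := h3
  have h4' : mulOp a (T f) x = a x • T f x := h4
  rw [h1, h3', h4', h2, map_smul]

theorem directIntegral_eq_of_ae_eq {R R' : X → E →L[ℂ] F} {T T' : Lp E 2 μ →L[ℂ] Lp F 2 μ}
    (h : ∀ f : Lp E 2 μ, ∀ᵐ x ∂μ, T f x = R x (f x))
    (h' : ∀ f : Lp E 2 μ, ∀ᵐ x ∂μ, T' f x = R' x (f x))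
    (hR : ∀ᵐ x ∂μ, R x = R' x) : T = T' := by
  refine ContinuousLinearMap.ext fun f => Lp.ext ?_
  filter_upwards [h f, h' f, hR] with x h1 h2 h3
  rw [h1, h2, h3]

/-- The operator `M_a` as a bounded operator. -/
def mulOpL (a : Lp ℂ ∞ μ) : Lp E 2 μ →L[ℂ] Lp E 2 μ :=
  LinearMap.mkContinuous
    { toFun := mulOp a
      map_add' := fun f g => Lp.add_smul a f g
      map_smul' := fun _ _ => (Lp.smul_comm _ _ _).symm } ‖a‖ fun f => Lp.norm_smul_le a f

theorem mulOp_ae (a : Lp ℂ ∞ μ) (f : Lp E 2 μ) : ∀ᵐ x ∂μ, mulOp a f x = a x • f x :=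
  Lp.coeFn_lpSMul (r := 2) a f

/-- `S` commutes with multiplication by indicators, so `⟨S f, S g⟩ = ⟨f, T g⟩` holds after
integration over every measurable set, hence pointwise. No decomposition of `S` into fibres is
needed. -/
theorem exists_commuting_sqrt [CompleteSpace E] {T : Lp E 2 μ →L[ℂ] Lp E 2 μ} (hT : T.IsPositive)
    (hMI : IsMI T) : ∃ S : Lp E 2 μ →L[ℂ] Lp E 2 μ, ∀ f g : Lp E 2 μ,
      ∀ᵐ x ∂μ, inner ℂ (S f x) (S g x) = inner ℂ (f x) (T g x) := by
  obtain ⟨S, hSsa, hSS, hS⟩ := exists_sqrt hT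
  have hcomm : ∀ (a : Lp ℂ ∞ μ) (f : Lp E 2 μ), S (mulOp a f) = mulOp a (S f) := fun a f =>
    congrArg (fun Q => Q f) (hS (mulOpL a) (ContinuousLinearMap.ext fun f => hMI a f)).eq
  refine ⟨S, fun f g => ?_⟩
  refine Integrable.ae_eq_of_forall_setIntegral_eq _ _ (L2.integrable_inner _ _)
    (L2.integrable_inner _ _) fun A hA _ => ?_
  have hmem : MemLp (A.indicator fun _ => (1 : ℂ)) ∞ μ :=
    (memLp_top_const (1 : ℂ)).indicator hA
  set a : Lp ℂ ∞ μ := hmem.toLp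
  have key : ∀ u v : Lp E 2 μ, ∫ x in A, inner ℂ (u x) (v x) ∂μ = inner ℂ u (mulOp a v) := by
    intro u v
    rw [L2.inner_def, ← integral_indicator hA]
    refine integral_congr_ae ?_
    filter_upwards [mulOp_ae a v, hmem.coeFn_toLp] with x h1 h2
    rw [h1, h2]
    by_cases hx : x ∈ A <;> simp [hx]
  rw [key, key, ← hcomm, ← hSS]
  have h3 : inner ℂ (S f) (S (mulOp a g)) = inner ℂ f (S (S (mulOp a g))) := by
    rw [← ContinuousLinearMap.adjoint_inner_right, hSsa.adjoint_eq]
  rw [h3, hcomm, hcomm]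
  rfl

end DirectIntegral

/-! ### Realizing a decomposable operator as a field of Gramians -/

section Realization

variable {I H : Type*} [NormedAddCommGroup H] [InnerProductSpace ℂ H]

theorem dimension_le_of_injective {V W : Type*} [AddCommGroup V] [Module ℂ V] [AddCommGroup W]
    [Module ℂ W] (f : V →ₗ[ℂ] W) (hf : Function.Injective f) : dimension V ≤ dimension W := by
  have := OrderHomClass.mono Cardinal.toENat (LinearMap.lift_rank_le_of_injective f hf)
  simpa [dimension] using this

theorem dimension_range_le {V W : Type*} [AddCommGroup V] [Module ℂ V] [AddCommGroup W]
    [Module ℂ W] (f : V →ₗ[ℂ] W) : dimension (LinearMap.range f) ≤ dimension V := by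
  have := OrderHomClass.mono Cardinal.toENat (lift_rank_range_le f)
  simpa [dimension] using this

/-- The analysis operator sends `w j` to `G (delta j)`, and is injective on the span: a vector it
kills is orthogonal to every `w i`, hence to itself. -/
theorem dimension_span_le {w : I → H} {G : Ell2 I →L[ℂ] Ell2 I}
    (h : ∀ i j, inner ℂ (delta i) (G (delta j)) = inner ℂ (w i) (w j)) :
    dimension (Submodule.span ℂ (Set.range w))
      ≤ dimension (LinearMap.range (G : Ell2 I →ₗ[ℂ] Ell2 I)) := by
  obtain ⟨T, hT, -⟩ := exists_analysis_of_gram h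
  have hmaps : ∀ v ∈ Submodule.span ℂ (Set.range w),
      T.toLinearMap v ∈ LinearMap.range (G : Ell2 I →ₗ[ℂ] Ell2 I) := by
    intro v hv
    have : Submodule.span ℂ (Set.range w) ≤ (LinearMap.range (G : Ell2 I →ₗ[ℂ] Ell2 I)).comap
        T.toLinearMap := by
      rw [Submodule.span_le]
      rintro _ ⟨j, rfl⟩
      refine ⟨delta j, ?_⟩
      ext i
      refine (inner_delta_left i _).symm.trans ((h i j).trans (hT _ _).symm)
    exact this hv
  refine dimension_le_of_injective (T.toLinearMap.restrict hmaps) ?_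
  rw [← LinearMap.ker_eq_bot, LinearMap.ker_eq_bot']
  rintro ⟨v, hv⟩ h0
  have h1 : T v = 0 := congrArg Subtype.val h0
  have h2 : v ∈ (Submodule.span ℂ (Set.range w))ᗮ := by
    rw [Submodule.mem_orthogonal]
    intro u hu
    induction hu using Submodule.span_induction with
    | mem u hu => obtain ⟨i, rfl⟩ := hu; rw [← hT v i, h1]; rfl
    | zero => simp
    | add _ _ _ _ h h' => rw [inner_add_left, h, h', add_zero]
    | smul c _ _ h => rw [inner_smul_left, h, mul_zero]
  exact Subtype.ext (inner_self_eq_zero.1 ((Submodule.mem_orthogonal _ _).1 h2 v hv))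

theorem IsGramian.dimension_range_le [CompleteSpace H] {u : I → H} {G : Ell2 I →L[ℂ] Ell2 I}
    (h : IsGramian u G) : dimension (LinearMap.range (G : Ell2 I →ₗ[ℂ] Ell2 I)) ≤ dimension H := by
  obtain ⟨T, -, rfl⟩ := h
  refine le_trans ?_ (MultInv.dimension_range_le T.toLinearMap)
  exact dimension_le_of_injective (Submodule.inclusion (by rintro _ ⟨v, rfl⟩; exact ⟨_, rfl⟩))
    (Submodule.inclusion_injective _)

variable {X : Type*} [MeasurableSpace X] {μ : Measure X} [SigmaFinite μ] [Countable I]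

/-- A positive, integrable decomposable operator of rank at most `dim H` is the Gramian of a
sequence in `L²(X; H)`. -/
theorem exists_realization {T : Lp (Ell2 I) 2 μ →L[ℂ] Lp (Ell2 I) 2 μ} (hT : T.IsPositive)
    {R : X → Ell2 I →L[ℂ] Ell2 I} (hR : IsDirectIntegral R T) (hint : IsIntegrableField μ R)
    (hdim : ∀ᵐ x ∂μ, dimension (LinearMap.range (R x : Ell2 I →ₗ[ℂ] Ell2 I)) ≤ dimension H) :
    ∃ φ : I → Lp H 2 μ, ∀ᵐ x ∂μ, ∀ i j,
      inner ℂ (delta i) (R x (delta j)) = inner ℂ (φ i x) (φ j x) := by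
  obtain ⟨η, hηm, hpos, hη⟩ := exists_weight μ
  have : Encodable I := Encodable.ofCountable I
  let f : I → Lp (Ell2 I) 2 μ := fun i => (memLp_weight_smul hη (delta i)).toLp
  obtain ⟨S, hS⟩ := exists_commuting_sqrt hT hR.isMI
  -- These play the role of the columns of `R(x)^{1/2}`, with the weight removed.
  let w : I → X → Ell2 I := fun i x => (η x : ℂ)⁻¹ • S (f i) x
  have hw : ∀ i, StronglyMeasurable (w i) := fun i =>
    (Complex.measurable_ofReal.comp hηm).inv.stronglyMeasurable.smul (Lp.stronglyMeasurable _)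
  have hgram : ∀ᵐ x ∂μ, ∀ i j, inner ℂ (delta i) (R x (delta j)) = inner ℂ (w i x) (w j x) := by
    refine ae_all_iff.2 fun i => ae_all_iff.2 fun j => ?_
    filter_upwards [hS (f i) (f j), hR.apply_ae (f j),
      (memLp_weight_smul hη (delta i)).coeFn_toLp, (memLp_weight_smul hη (delta j)).coeFn_toLp]
      with x h1 h2 h3 h4
    have hne : (η x : ℂ) ≠ 0 := Complex.ofReal_ne_zero.2 (hpos x).ne'
    simp only [w, inner_smul_left, inner_smul_right, h1, h2, f, h3, h4, map_smul]
    simp only [map_inv₀, Complex.conj_ofReal]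
    field_simp
  -- Codes of no index get the zero field, which does not enlarge the span.
  let w' : ℕ → X → Ell2 I := fun n => (Encodable.decode n : Option I).elim 0 w
  have hw' : ∀ n, StronglyMeasurable (w' n) := fun n => by
    simp only [w']
    cases (Encodable.decode n : Option I) with
    | none => exact stronglyMeasurable_zero
    | some i => exact hw i
  obtain ⟨ψ, hψ, hψg⟩ := exists_measurable_gram (H := H) hw'
  have hψgram : ∀ᵐ x ∂μ, ∀ i j, inner ℂ (delta i) (R x (delta j)) =
      inner ℂ (ψ (Encodable.encode i) x) (ψ (Encodable.encode j) x) := by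
    filter_upwards [hgram, hdim] with x h1 h2 i j
    rw [hψg x, h1]
    · simp [w']
    · refine le_trans ?_ ((dimension_span_le h1).trans h2)
      refine dimension_le_of_injective (Submodule.inclusion ?_) (Submodule.inclusion_injective _)
      rw [Submodule.span_le]
      rintro _ ⟨n, rfl⟩
      simp only [w']
      cases (Encodable.decode n : Option I) with
      | none => exact Submodule.zero_mem _
      | some i => exact Submodule.subset_span ⟨i, rfl⟩
  have hmem : ∀ i : I, MemLp (ψ (Encodable.encode i)) 2 μ := fun i => by
    rw [memLp_two_iff_integrable_sq_norm (hψ _).aestronglyMeasurable]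
    refine (hint i).norm.congr ?_
    filter_upwards [hψgram] with x hx
    rw [hx, inner_self_eq_norm_sq_to_K]
    simp
  refine ⟨fun i => (hmem i).toLp, ?_⟩
  filter_upwards [hψgram, ae_all_iff.2 fun i => (hmem i).coeFn_toLp] with x h1 h2 i j
  rw [h1, h2, h2]

end Realization

/-! ### Multiplication systems -/

section System

variable {X Y H I : Type*} [MeasurableSpace X] {μ : Measure X}
  [NormedAddCommGroup H] [InnerProductSpace ℂ H] [MeasurableSpace Y] {ν : Measure Y}
  {g : Y → Lp ℂ ∞ μ}

theorem inner_mulOp (a : Lp ℂ ∞ μ) (f v : Lp H 2 μ) :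
    inner ℂ (mulOp a f) v = ∫ x, inner ℂ (f x) (v x) * conj (a x) ∂μ := by
  rw [L2.inner_def]
  refine integral_congr_ae ?_
  filter_upwards [mulOp_ae a f] with x hx
  rw [hx, inner_smul_left, mul_comm]

theorem integrable_inner_mul_conj (a : Lp ℂ ∞ μ) (f v : Lp H 2 μ) :
    Integrable (fun x => inner ℂ (f x) (v x) * conj (a x)) μ := by
  refine (L2.integrable_inner (𝕜 := ℂ) (mulOp a f) v).congr ?_
  filter_upwards [mulOp_ae a f] with x hx
  rw [hx, inner_smul_left, mul_comm]

omit [MeasurableSpace Y] in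
theorem integral_toL1_mul {f : X → ℂ} (hf : Integrable f μ) (t : Y) :
    ∫ x, hf.toL1 f x * conj (g t x) ∂μ = ∫ x, f x * conj (g t x) ∂μ :=
  integral_congr_ae (hf.coeFn_toL1.mono fun x hx => by simp only [hx])

theorem IsParsevalDetermining.measurable_integral (hg : IsParsevalDetermining μ ν g) {f : X → ℂ}
    (hf : Integrable f μ) : Measurable fun t => ∫ x, f x * conj (g t x) ∂μ := by
  simpa only [integral_toL1_mul hf] using hg.measurable (hf.toL1 f)

theorem IsParsevalDetermining.lintegral_integral (hg : IsParsevalDetermining μ ν g) {f : X → ℂ}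
    (hf : Integrable f μ) :
    ∫⁻ t, ‖∫ x, f x * conj (g t x) ∂μ‖ₑ ^ 2 ∂ν = ∫⁻ x, ‖f x‖ₑ ^ 2 ∂μ := by
  have := hg.parseval (hf.toL1 f)
  simp only [integral_toL1_mul hf] at this
  rw [this]
  exact lintegral_congr_ae (hf.coeFn_toL1.mono fun x hx => by simp only [hx])

theorem IsParsevalDetermining.ae_eq_zero (hg : IsParsevalDetermining μ ν g) {f : X → ℂ}
    (hf : Integrable f μ) (h : ∀ t, ∫ x, f x * conj (g t x) ∂μ = 0) : ∀ᵐ x ∂μ, f x = 0 := by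
  have := hg.lintegral_integral hf
  simp only [h] at this
  have h0 : ∫⁻ x, ‖f x‖ₑ ^ 2 ∂μ = 0 := by rw [← this]; simp
  rw [lintegral_eq_zero_iff' (hf.1.enorm.pow_const 2)] at h0
  filter_upwards [h0] with x hx
  simpa using hx

theorem IsParsevalDetermining.measurable_multSystem [Countable I] [MeasurableSpace I]
    [DiscreteMeasurableSpace I] (hg : IsParsevalDetermining μ ν g) (φ : I → Lp H 2 μ)
    (v : Lp H 2 μ) : Measurable fun p => inner ℂ (multSystem g φ p) v := by
  refine measurable_from_prod_countable_left fun i => ?_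
  simp only [multSystem, inner_mulOp]
  exact hg.measurable_integral (L2.integrable_inner _ _)

/-- For each `i` the determining identity applies to the L¹ function `⟨v, φ i⟩`; Tonelli then sums
over `i`. No Bessel assumption is needed, as both sides may be infinite. -/
theorem IsParsevalDetermining.lintegral_multSystem [Countable I] [MeasurableSpace I]
    [DiscreteMeasurableSpace I] [SigmaFinite ν] (hg : IsParsevalDetermining μ ν g)
    (φ : I → Lp H 2 μ) (v : Lp H 2 μ) :
    ∫⁻ p, ‖inner ℂ (multSystem g φ p) v‖ₑ ^ 2 ∂(ν.prod Measure.count)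
      = ∫⁻ x, ∑' i, ‖inner ℂ (φ i x) (v x)‖ₑ ^ 2 ∂μ := by
  rw [lintegral_prod_symm _ ((hg.measurable_multSystem φ v).enorm.pow_const 2).aemeasurable,
    lintegral_count, lintegral_tsum fun i => (L2.integrable_inner (𝕜 := ℂ) _ _).1.enorm.pow_const 2]
  refine tsum_congr fun i => ?_
  simp only [multSystem, inner_mulOp]
  exact hg.lintegral_integral (L2.integrable_inner _ _)

/-- Systems are unitarily equivalent iff their generators have the same fibrewise Gram matrices. -/
theorem IsParsevalDetermining.unitarilyEquivalent_iff [Countable I]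
    (hg : IsParsevalDetermining μ ν g) [CompleteSpace H] (φ ψ : I → Lp H 2 μ) :
    UnitarilyEquivalent (multSystem g φ) (multSystem g ψ) ↔
      ∀ᵐ x ∂μ, ∀ i j, inner ℂ (φ i x) (φ j x) = inner ℂ (ψ i x) (ψ j x) := by
  rw [MultInv.unitarilyEquivalent_iff]
  constructor
  · intro h
    refine ae_all_iff.2 fun i => ae_all_iff.2 fun j => ?_
    -- For fixed `s`, `g s` times the difference of Gram entries integrates to zero against every
    -- `conj (g t)`, so it vanishes.
    have h1 : ∀ s, ∀ᵐ x ∂μ, g s x * (inner ℂ (φ i x) (φ j x) - inner ℂ (ψ i x) (ψ j x)) = 0 := by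
      intro s
      have h2 := hg.ae_eq_zero ((L2.integrable_inner (𝕜 := ℂ) (φ i) (mulOp (g s) (φ j))).sub
        (L2.integrable_inner (𝕜 := ℂ) (ψ i) (mulOp (g s) (ψ j)))) fun t => ?_
      · filter_upwards [h2, mulOp_ae (g s) (φ j), mulOp_ae (g s) (ψ j)] with x h3 h4 h5
        rw [Pi.sub_apply, h4, h5, inner_smul_right, inner_smul_right] at h3
        rw [mul_sub, h3]
      · have h6 := h (t, i) (s, j)
        simp only [multSystem] at h6
        rw [inner_mulOp, inner_mulOp, ← sub_eq_zero, ← integral_sub] at h6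
        · simpa only [Pi.sub_apply, sub_mul] using h6
        · exact integrable_inner_mul_conj _ _ _
        · exact integrable_inner_mul_conj _ _ _
    -- The null set in `h1` depends on `s`, and `Y` may be uncountable. Integrating `h1` and using
    -- the determining property again on the conjugate difference avoids intersecting them.
    have h7 := hg.ae_eq_zero (f := fun x =>
      conj (inner ℂ (φ i x) (φ j x) - inner ℂ (ψ i x) (ψ j x))) ?_ fun t => ?_
    · filter_upwards [h7] with x hx
      rw [map_eq_zero] at hx
      exact sub_eq_zero.1 hx
    · have := ((L2.integrable_inner (𝕜 := ℂ) (φ i) (φ j)).sub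
        (L2.integrable_inner (𝕜 := ℂ) (ψ i) (ψ j)))
      exact (RCLike.conjCLE (K := ℂ)).toContinuousLinearMap.integrable_comp this
    · refine integral_eq_zero_of_ae ?_
      filter_upwards [h1 t] with x hx
      rw [← map_mul, mul_comm, hx, map_zero, Pi.zero_apply]
  · rintro h ⟨t, i⟩ ⟨s, j⟩
    simp only [multSystem, inner_mulOp]
    refine integral_congr_ae ?_
    filter_upwards [h, mulOp_ae (g s) (φ j), mulOp_ae (g s) (ψ j)] with x h3 h4 h5
    rw [h4, h5, inner_smul_right, inner_smul_right, h3]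

omit [InnerProductSpace ℂ H] in
theorem enorm_sq_Lp (v : Lp H 2 μ) : ‖v‖ₑ ^ 2 = ∫⁻ x, ‖v x‖ₑ ^ 2 ∂μ := by
  rw [Lp.enorm_def]
  have := eLpNorm_nnreal_pow_eq_lintegral (f := v) (μ := μ) (p := 2) two_ne_zero
  simpa using this

theorem enorm_sq_ell2 (c : Ell2 I) : ‖c‖ₑ ^ 2 = ∑' i, ‖c i‖ₑ ^ 2 := by
  have h := lp.hasSum_norm (p := 2) (by norm_num) c
  simp only [ENNReal.toReal_ofNat, Real.rpow_two] at h
  have h1 := ENNReal.ofReal_tsum_of_nonneg (fun i => sq_nonneg ‖c i‖) h.summable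
  rw [h.tsum_eq] at h1
  simpa only [ENNReal.ofReal_pow (norm_nonneg _), ofReal_norm] using h1

/-- Testing on indicators times a fixed vector localizes the bound. Finite subsets of `I` and a
dense sequence in `H` give one common null set, and continuity covers the remaining vectors. -/
theorem ae_bessel [SigmaFinite μ] [Countable I] [TopologicalSpace.SeparableSpace H]
    (φ : I → Lp H 2 μ) {B : ℝ} (hB : 0 ≤ B)
    (h : ∀ v : Lp H 2 μ, ∫⁻ x, ∑' i, ‖inner ℂ (φ i x) (v x)‖ₑ ^ 2 ∂μ
      ≤ ENNReal.ofReal B * ‖v‖ₑ ^ 2) :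
    ∀ᵐ x ∂μ, ∀ (s : Finset I) (u : H), ∑ i ∈ s, ‖inner ℂ (φ i x) u‖ ^ 2 ≤ B * ‖u‖ ^ 2 := by
  have key : ∀ (s : Finset I) (u : H),
      ∀ᵐ x ∂μ, ∑ i ∈ s, ‖inner ℂ (φ i x) u‖ₑ ^ 2 ≤ ENNReal.ofReal B * ‖u‖ₑ ^ 2 := by
    intro s u
    refine ae_le_of_forall_setLIntegral_le_of_sigmaFinite ?_ fun A hA hμA => ?_
    · refine Finset.measurable_fun_sum _ fun i _ => ?_
      exact ((Lp.stronglyMeasurable (φ i)).inner stronglyMeasurable_const).enorm.pow_const 2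
    · have h1 := h (indicatorConstLp 2 hA hμA.ne u)
      rw [enorm_sq_Lp, ← lintegral_const_mul' _ _ ENNReal.ofReal_ne_top] at h1
      rw [← lintegral_indicator hA, ← lintegral_indicator hA]
      refine le_trans (lintegral_mono_ae ?_) (h1.trans (lintegral_mono_ae ?_))
      all_goals
        filter_upwards [indicatorConstLp_coeFn (p := 2) (hs := hA) (hμs := hμA.ne) (c := u)]
          with x hx
        rw [hx]
        by_cases hxA : x ∈ A
      · simpa [hxA] using ENNReal.sum_le_tsum s
      · simp [hxA]
      · simp [hxA]
      · simp [hxA]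
  have h2 : ∀ᵐ x ∂μ, ∀ (s : Finset I) (n : ℕ),
      ∑ i ∈ s, ‖inner ℂ (φ i x) (TopologicalSpace.denseSeq H n)‖ₑ ^ 2
        ≤ ENNReal.ofReal B * ‖TopologicalSpace.denseSeq H n‖ₑ ^ 2 :=
    ae_all_iff.2 fun s => ae_all_iff.2 fun n => key s _
  filter_upwards [h2] with x hx s u
  refine (TopologicalSpace.denseRange_denseSeq H).induction_on (p := fun u =>
    ∑ i ∈ s, ‖inner ℂ (φ i x) u‖ ^ 2 ≤ B * ‖u‖ ^ 2) u
    (isClosed_le (by fun_prop) (by fun_prop)) fun n => ?_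
  have := hx s n
  simp only [← ofReal_norm, ← ENNReal.ofReal_pow (norm_nonneg _)] at this
  rw [← ENNReal.ofReal_sum_of_nonneg fun i _ => by positivity, ← ENNReal.ofReal_mul hB,
    ENNReal.ofReal_le_ofReal_iff (by positivity)] at this
  exact this

end System

/-! ### The analysis operator of a sequence of generators -/

section Analysis

variable {X H I : Type*} [MeasurableSpace X] {μ : Measure X}
  [NormedAddCommGroup H] [InnerProductSpace ℂ H] [CompleteSpace H]

/-- `T` is the fibrewise analysis operator of `φ`, and `R` is the field of Gramians. -/
structure IsFibreAnalysis (φ : I → Lp H 2 μ) (T : Lp H 2 μ →L[ℂ] Lp (Ell2 I) 2 μ)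
    (R : X → Ell2 I →L[ℂ] Ell2 I) : Prop where
  enorm_sq : ∀ v, ‖T v‖ₑ ^ 2 = ∫⁻ x, ∑' i, ‖inner ℂ (φ i x) (v x)‖ₑ ^ 2 ∂μ
  directIntegral : IsDirectIntegral R (T ∘L ContinuousLinearMap.adjoint T)
  gramian : ∀ᵐ x ∂μ, IsGramian (fun i => φ i x) (R x)

theorem exists_fibreAnalysis [μ.IsComplete] [Countable I] [TopologicalSpace.SeparableSpace H]
    (φ : I → Lp H 2 μ) {C : ℝ}
    (h : ∀ᵐ x ∂μ, ∃ T : H →L[ℂ] Ell2 I, IsAnalysisOperator (fun i => φ i x) T ∧ ‖T‖ ≤ C) :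
    ∃ T R, IsFibreAnalysis φ T R := by
  classical
  have := separableSpace_ell2 (I := I)
  let K : X → H →L[ℂ] Ell2 I := fun x =>
    if hx : ∃ T : H →L[ℂ] Ell2 I, IsAnalysisOperator (fun i => φ i x) T ∧ ‖T‖ ≤ C
    then hx.choose else 0
  have hK : ∀ᵐ x ∂μ, IsAnalysisOperator (fun i => φ i x) (K x) ∧ ‖K x‖ ≤ C := by
    filter_upwards [h] with x hx
    simp only [K, dif_pos hx]
    exact hx.choose_spec
  have hKm : ∀ (u : H) (v : Ell2 I), Measurable fun x => inner ℂ v (K x u) := by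
    intro u v
    -- `K` is tied to `φ` only almost everywhere; completeness of `μ` turns almost everywhere
    -- measurability into measurability.
    refine NullMeasurable.measurable_of_complete (μ := μ) (AEMeasurable.nullMeasurable ?_)
    refine aemeasurable_of_tendsto_metrizable_ae (u := (atTop : Filter (Finset I)))
      (f := fun s x => ∑ i ∈ s, inner ℂ (v i) (inner ℂ (φ i x) u : ℂ)) (fun s => ?_) ?_
    · refine (Finset.stronglyMeasurable_fun_sum _ fun i _ => ?_).measurable.aemeasurable
      exact stronglyMeasurable_const.inner
        ((Lp.stronglyMeasurable (φ i)).inner stronglyMeasurable_const)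
    · filter_upwards [hK] with x hx
      have := lp.hasSum_inner (𝕜 := ℂ) v (K x u)
      simp only [hx.1 u] at this
      exact this
  have hKm' : ∀ (u : Ell2 I) (v : H),
      Measurable fun x => inner ℂ v (ContinuousLinearMap.adjoint (K x) u) := by
    intro u v
    have : (fun x => inner ℂ v (ContinuousLinearMap.adjoint (K x) u))
        = fun x => conj (inner ℂ u (K x v)) := by
      funext x
      rw [ContinuousLinearMap.adjoint_inner_right, inner_conj_symm]
    rw [this]
    exact Complex.continuous_conj.measurable.comp (hKm v u)
  obtain ⟨T, hT⟩ := exists_directIntegral hKm ⟨C, hK.mono fun x hx => hx.2⟩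
  obtain ⟨T', hT'⟩ := exists_directIntegral hKm' ⟨C, hK.mono fun x hx => by
    rw [LinearIsometryEquiv.norm_map]; exact hx.2⟩
  have hadj : T' = ContinuousLinearMap.adjoint T := adjoint_directIntegral hT hT'
  refine ⟨T, fun x => K x ∘L ContinuousLinearMap.adjoint (K x), fun v => ?_, ⟨fun u v => ?_,
    ⟨C * C, ?_⟩, fun f => ?_⟩, hK.mono fun x hx => ⟨K x, hx.1, rfl⟩⟩
  · rw [enorm_sq_Lp]
    refine lintegral_congr_ae ?_
    filter_upwards [hT v, hK] with x h1 h2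
    rw [h1, enorm_sq_ell2]
    simp only [h2.1 (v x)]
  · have h1 : StronglyMeasurable fun x => ContinuousLinearMap.adjoint (K x) u :=
      stronglyMeasurable_of_inner (hKm' u)
    exact (stronglyMeasurable_const.inner (stronglyMeasurable_field_apply hKm h1)).measurable
  · filter_upwards [hK] with x hx
    refine (ContinuousLinearMap.opNorm_comp_le _ _).trans ?_
    rw [LinearIsometryEquiv.norm_map]
    exact mul_le_mul hx.2 hx.2 (norm_nonneg _) ((norm_nonneg _).trans hx.2)
  · rw [← hadj]
    filter_upwards [hT (T' f), hT' f] with x h1 h2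
    rw [ContinuousLinearMap.comp_apply, h1, h2]
    rfl

end Analysis

/-! ### Frames of multiplications -/

section FrameBounds

variable {X Y H I : Type*} [MeasurableSpace X] {μ : Measure X}
  [NormedAddCommGroup H] [InnerProductSpace ℂ H] [CompleteSpace H]
  [MeasurableSpace Y] {ν : Measure Y} {g : Y → Lp ℂ ∞ μ}

instance completeSpace_closedSpan {M K : Type*} [NormedAddCommGroup K] [InnerProductSpace ℂ K]
    [CompleteSpace K] (u : M → K) : CompleteSpace (closedSpan u) :=
  (Submodule.isClosed_topologicalClosure _).completeSpace_coe

theorem mem_orthogonal_closedSpan_iff {M K : Type*} [NormedAddCommGroup K] [InnerProductSpace ℂ K]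
    (u : M → K) (v : K) : v ∈ (closedSpan u)ᗮ ↔ ∀ s, inner ℂ (u s) v = 0 := by
  rw [closedSpan, Submodule.orthogonal_closure, Submodule.mem_orthogonal]
  refine ⟨fun h s => h _ (Submodule.subset_span ⟨s, rfl⟩), fun h w hw => ?_⟩
  induction hw using Submodule.span_induction with
  | mem w hw => obtain ⟨s, rfl⟩ := hw; exact h s
  | zero => simp
  | add _ _ _ _ h h' => rw [inner_add_left, h, h', add_zero]
  | smul c _ _ h => rw [inner_smul_left, h, mul_zero]

theorem enorm_sq_le_iff {K L : Type*} [NormedAddCommGroup K] [NormedAddCommGroup L] {A : ℝ}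
    (hA : 0 ≤ A) (v : K) (w : L) :
    ENNReal.ofReal A * ‖v‖ₑ ^ 2 ≤ ‖w‖ₑ ^ 2 ↔ A * ‖v‖ ^ 2 ≤ ‖w‖ ^ 2 := by
  simp only [← ofReal_norm, ← ENNReal.ofReal_pow (norm_nonneg _)]
  rw [← ENNReal.ofReal_mul hA, ENNReal.ofReal_le_ofReal_iff (by positivity)]

theorem le_enorm_sq_iff {K L : Type*} [NormedAddCommGroup K] [NormedAddCommGroup L] {B : ℝ}
    (hB : 0 ≤ B) (v : K) (w : L) :
    ‖w‖ₑ ^ 2 ≤ ENNReal.ofReal B * ‖v‖ₑ ^ 2 ↔ ‖w‖ ^ 2 ≤ B * ‖v‖ ^ 2 := by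
  simp only [← ofReal_norm, ← ENNReal.ofReal_pow (norm_nonneg _)]
  rw [← ENNReal.ofReal_mul hB, ENNReal.ofReal_le_ofReal_iff (by positivity)]

variable [Countable I] [MeasurableSpace I] [DiscreteMeasurableSpace I] [SigmaFinite ν]

/-- `‖T v‖²` is the energy of the frame coefficients. If it vanishes, so do the fibrewise products,
hence the coefficient at every `(t, i)`, not merely almost every one. -/
theorem IsFibreAnalysis.apply_eq_zero_iff (hg : IsParsevalDetermining μ ν g) {φ : I → Lp H 2 μ}
    {T : Lp H 2 μ →L[ℂ] Lp (Ell2 I) 2 μ} {R : X → Ell2 I →L[ℂ] Ell2 I}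
    (hT : IsFibreAnalysis φ T R) (v : Lp H 2 μ) :
    v ∈ (closedSpan (multSystem g φ))ᗮ ↔ T v = 0 := by
  rw [mem_orthogonal_closedSpan_iff]
  constructor
  · intro h
    have h1 := hT.enorm_sq v
    rw [← hg.lintegral_multSystem] at h1
    simpa [h] using h1
  · rintro h ⟨t, i⟩
    have h1 := hT.enorm_sq v
    have hm : ∀ i, AEMeasurable (fun x => ‖inner ℂ (φ i x) (v x)‖ₑ ^ 2) μ := fun i =>
      (L2.integrable_inner (𝕜 := ℂ) _ _).1.enorm.pow_const 2
    rw [h, enorm_zero, zero_pow two_ne_zero, eq_comm,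
      lintegral_eq_zero_iff' (AEMeasurable.tsum hm)] at h1
    simp only [multSystem]
    rw [inner_mulOp]
    refine integral_eq_zero_of_ae ?_
    filter_upwards [h1] with x hx
    have : inner ℂ (φ i x) (v x) = 0 := by
      have := (ENNReal.tsum_eq_zero.1 hx) i
      simpa using this
    simp [this]

/-- The frame inequalities bound `‖T v‖²` on `(ker T)ᗮ`; the lower one is moved to `T T*` so that it
becomes a condition on the Gramian field. -/
theorem IsFibreAnalysis.isFrame_iff (hg : IsParsevalDetermining μ ν g) {φ : I → Lp H 2 μ}
    {T : Lp H 2 μ →L[ℂ] Lp (Ell2 I) 2 μ} {R : X → Ell2 I →L[ℂ] Ell2 I}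
    (hT : IsFibreAnalysis φ T R) {A B : ℝ} (hA : 0 < A) (hB : 0 < B) :
    IsFrame (ν.prod Measure.count) (inClosedSpan (multSystem g φ)) A B ↔
      (∀ v, ‖T v‖ ^ 2 ≤ B * ‖v‖ ^ 2) ∧
        ∀ f, A * (inner ℂ ((T ∘L ContinuousLinearMap.adjoint T) f) f).re
          ≤ ‖(T ∘L ContinuousLinearMap.adjoint T) f‖ ^ 2 := by
  have hker := hT.apply_eq_zero_iff hg
  rw [← forall_orthogonal_ker_iff T hker]
  have hQ : ∀ v : closedSpan (multSystem g φ),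
      ∫⁻ p, ‖inner ℂ (inClosedSpan (multSystem g φ) p) v‖ₑ ^ 2 ∂(ν.prod Measure.count)
        = ‖T v‖ₑ ^ 2 := fun v => by
    rw [hT.enorm_sq, ← hg.lintegral_multSystem]
    rfl
  constructor
  · intro h
    refine ⟨norm_sq_le_of_orthogonal T (fun v => (hker v).1) (fun v hv => ?_) hB.le, fun v hv => ?_⟩
    · have := h.bessel.upper ⟨v, hv⟩
      rw [hQ] at this
      exact (le_enorm_sq_iff hB.le _ _).1 this
    · have := h.lower ⟨v, hv⟩
      rw [hQ] at this
      exact (enorm_sq_le_iff hA.le _ _).1 this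
  · rintro ⟨h1, h2⟩
    refine ⟨hA, hB, ⟨fun v => hg.measurable_multSystem φ v, fun v => ?_⟩, fun v => ?_⟩
    · rw [hQ]
      exact (le_enorm_sq_iff hB.le _ _).2 (h1 v)
    · rw [hQ]
      exact (enorm_sq_le_iff hA.le _ _).2 (h2 v v.2)

variable [SigmaFinite μ] [μ.IsComplete] [TopologicalSpace.SeparableSpace H]

theorem exists_fibreAnalysis_of_isFrame (hg : IsParsevalDetermining μ ν g) {φ : I → Lp H 2 μ}
    {A B : ℝ} (h : IsFrame (ν.prod Measure.count) (inClosedSpan (multSystem g φ)) A B) :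
    ∃ T R, IsFibreAnalysis φ T R := by
  refine exists_fibreAnalysis (C := Real.sqrt B) φ ?_
  have hbessel : ∀ v : Lp H 2 μ, ∫⁻ x, ∑' i, ‖inner ℂ (φ i x) (v x)‖ₑ ^ 2 ∂μ
      ≤ ENNReal.ofReal B * ‖v‖ₑ ^ 2 := by
    intro v
    rw [← hg.lintegral_multSystem]
    set S := closedSpan (multSystem g φ)
    -- The Bessel bound is known only on the closed span; projecting `v` there leaves its
    -- coefficients unchanged.
    have h1 : ∀ p, inner ℂ (multSystem g φ p) v
        = inner ℂ (inClosedSpan (multSystem g φ) p) (S.orthogonalProjectionOnto v) := by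
      intro p
      have := (mem_orthogonal_closedSpan_iff _ _).1 (S.sub_starProjection_mem_orthogonal v) p
      rw [inner_sub_right, sub_eq_zero] at this
      exact this
    simp only [h1]
    refine (h.bessel.upper _).trans ?_
    gcongr
    exact enorm_le_iff_norm_le.2 (S.norm_orthogonalProjectionOnto_apply_le v)
  filter_upwards [ae_bessel φ h.upper_pos.le hbessel] with x hx
  exact exists_analysis _ B h.upper_pos.le hx

omit [MeasurableSpace I] [DiscreteMeasurableSpace I] in
theorem exists_fibreAnalysis_of_positive {G : Lp (Ell2 I) 2 μ →L[ℂ] Lp (Ell2 I) 2 μ}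
    (hG : G.IsPositive) {R : X → Ell2 I →L[ℂ] Ell2 I} (hR : IsDirectIntegral R G)
    (hint : IsIntegrableField μ R)
    (hdim : ∀ᵐ x ∂μ, dimension (LinearMap.range (R x : Ell2 I →ₗ[ℂ] Ell2 I)) ≤ dimension H) :
    ∃ (φ : I → Lp H 2 μ) (T : Lp H 2 μ →L[ℂ] Lp (Ell2 I) 2 μ) (R' : X → Ell2 I →L[ℂ] Ell2 I),
      IsFibreAnalysis φ T R' ∧ T ∘L ContinuousLinearMap.adjoint T = G ∧
        ∀ᵐ x ∂μ, IsGramian (fun i => φ i x) (R x) := by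
  obtain ⟨φ, hφ⟩ := exists_realization (H := H) hG hR hint hdim
  obtain ⟨C, hC⟩ := hR.bounded
  obtain ⟨T, R', hT⟩ := exists_fibreAnalysis (C := Real.sqrt C) φ (by
    filter_upwards [hφ, hC] with x h1 h2
    obtain ⟨T, hT, hn⟩ := exists_analysis_of_gram h1
    exact ⟨T, hT, hn.trans (Real.sqrt_le_sqrt h2)⟩)
  refine ⟨φ, T, R', hT, directIntegral_eq_of_ae_eq hT.directIntegral.apply_ae hR.apply_ae ?_, ?_⟩
  · filter_upwards [hφ, hT.gramian] with x h1 h2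
    exact ext_inner_delta fun i j => by rw [h1, h2.inner_delta]
  · filter_upwards [hφ] with x h1
    exact isGramian_iff.2 h1

omit [CompleteSpace H] [Countable I] [MeasurableSpace I] [DiscreteMeasurableSpace I]
  [SigmaFinite μ] [μ.IsComplete] [TopologicalSpace.SeparableSpace H] in
theorem isIntegrableField_of_gram {φ : I → Lp H 2 μ} {R : X → Ell2 I →L[ℂ] Ell2 I}
    (h : ∀ᵐ x ∂μ, ∀ i j, inner ℂ (delta i) (R x (delta j)) = inner ℂ (φ i x) (φ j x)) :
    IsIntegrableField μ R := fun i =>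
  (L2.integrable_inner (𝕜 := ℂ) (φ i) (φ i)).congr (h.mono fun _ hx => (hx i i).symm)

end FrameBounds

/-! ### Idempotent Gramians and Parseval bounds -/

section Projections

variable {K : Type*} [NormedAddCommGroup K] [InnerProductSpace ℂ K] [CompleteSpace K]

/-- The fixed space of a bounded operator. -/
def fixedSpace (P : K →L[ℂ] K) : ClosedSubmodule ℂ K :=
  ⟨LinearMap.ker (P - 1).toLinearMap, (P - 1).isClosed_ker⟩

omit [CompleteSpace K] in
theorem mem_fixedSpace {P : K →L[ℂ] K} {v : K} : v ∈ (fixedSpace P).toSubmodule ↔ P v = v := by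
  change (P - 1) v = 0 ↔ _
  rw [_root_.sub_apply, sub_eq_zero]
  rfl

theorem starProjection_fixedSpace {P : K →L[ℂ] K} (hP : IsSelfAdjoint P) (h : P * P = P) :
    (fixedSpace P).toSubmodule.starProjection = P := by
  ext v
  refine Submodule.eq_starProjection_of_mem_of_inner_eq_zero
    (mem_fixedSpace.2 (congrArg (fun Q => Q v) h)) fun w hw => ?_
  have h1 : inner ℂ (P v) w = inner ℂ v (P w) := by
    rw [← ContinuousLinearMap.adjoint_inner_right, hP.adjoint_eq]
  rw [inner_sub_left, h1, mem_fixedSpace.1 hw, sub_self]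

theorem re_inner_comp_adjoint {L : Type*} [NormedAddCommGroup L] [InnerProductSpace ℂ L]
    [CompleteSpace L] (T : K →L[ℂ] L) (f : L) :
    (inner ℂ ((T ∘L ContinuousLinearMap.adjoint T) f) f).re
      = ‖ContinuousLinearMap.adjoint T f‖ ^ 2 := by
  rw [ContinuousLinearMap.comp_apply, ← ContinuousLinearMap.adjoint_inner_right,
    inner_self_eq_norm_sq_to_K]
  simp [← Complex.ofReal_pow]

/-- `T` is a partial isometry iff `T T*` is idempotent. -/
theorem norm_sq_le_and_iff {L : Type*} [NormedAddCommGroup L] [InnerProductSpace ℂ L]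
    [CompleteSpace L] (T : K →L[ℂ] L) :
    ((∀ v, ‖T v‖ ^ 2 ≤ 1 * ‖v‖ ^ 2) ∧
        ∀ f, 1 * (inner ℂ ((T ∘L ContinuousLinearMap.adjoint T) f) f).re
          ≤ ‖(T ∘L ContinuousLinearMap.adjoint T) f‖ ^ 2) ↔
      (T ∘L ContinuousLinearMap.adjoint T) * (T ∘L ContinuousLinearMap.adjoint T)
        = T ∘L ContinuousLinearMap.adjoint T := by
  have hpos : (T ∘L ContinuousLinearMap.adjoint T).IsPositive :=
    ContinuousLinearMap.isPositive_self_comp_adjoint T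
  constructor
  · rintro ⟨h1, h2⟩
    -- The lower bound reads `‖T* f‖² ≤ ‖T T* f‖²`; the upper bound at `T* f` is the reverse.
    refine mul_self_eq_of_norm_sq hpos fun f => le_antisymm (by simpa using h2 f) ?_
    rw [re_inner_comp_adjoint]
    simpa using h1 (ContinuousLinearMap.adjoint T f)
  · intro h
    have key : ∀ f, (inner ℂ ((T ∘L ContinuousLinearMap.adjoint T) f) f).re
        = ‖(T ∘L ContinuousLinearMap.adjoint T) f‖ ^ 2 := fun f => by
      have h1 := congrArg (fun Q => inner ℂ (Q f) f) h
      simp only [_root_.mul_apply_eq_comp] at h1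
      rw [hpos.inner_left_eq_inner_right, inner_self_eq_norm_sq_to_K] at h1
      rw [← h1]
      simp [← Complex.ofReal_pow]
    refine ⟨fun v => ?_, fun f => by rw [one_mul, key]⟩
    have h2 : ∀ f, ‖ContinuousLinearMap.adjoint T f‖ ≤ 1 * ‖f‖ := fun f => by
      have h3 := key f
      have h4 : ‖(T ∘L ContinuousLinearMap.adjoint T) f‖ ^ 2
          ≤ ‖(T ∘L ContinuousLinearMap.adjoint T) f‖ * ‖f‖ := by
        rw [← h3]
        exact (Complex.re_le_norm _).trans (norm_inner_le_norm _ _)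
      have h5 : ‖(T ∘L ContinuousLinearMap.adjoint T) f‖ ≤ ‖f‖ := by
        by_contra! h6
        nlinarith [norm_nonneg f]
      rw [re_inner_comp_adjoint] at h3
      have h6 := (sq_eq_sq₀ (norm_nonneg _) (norm_nonneg _)).1 h3
      rw [h6, one_mul]
      exact h5
    have h7 : ‖T‖ ≤ 1 := by
      rw [← LinearIsometryEquiv.norm_map ContinuousLinearMap.adjoint T]
      exact ContinuousLinearMap.opNorm_le_bound _ zero_le_one h2
    have h8 := T.le_of_opNorm_le h7 v
    rw [one_mul] at h8 ⊢
    gcongr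

omit [CompleteSpace K] in
theorem dimension_range_starProjection (U : Submodule ℂ K) [U.HasOrthogonalProjection] :
    dimension (LinearMap.range (U.starProjection : K →ₗ[ℂ] K)) = dimension U :=
  congrArg (fun V : Submodule ℂ K => dimension V) (Submodule.range_starProjection U)

theorem isSelfAdjoint_of_isGramian {I : Type*} {u : I → K} {G : Ell2 I →L[ℂ] Ell2 I}
    (h : IsGramian u G) : IsSelfAdjoint G := by
  obtain ⟨T, -, rfl⟩ := h
  exact (ContinuousLinearMap.isPositive_self_comp_adjoint T).isSelfAdjoint

end Projections

end MultInv

end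

open MultInv

/-! ### The two correspondences -/

theorem mainTheorem5
    {X Y H I : Type*}
    [MeasurableSpace X] (μ : Measure X) [SigmaFinite μ] [μ.IsComplete]
    [TopologicalSpace.SeparableSpace (Lp ℂ 2 μ)]
    [NormedAddCommGroup H] [InnerProductSpace ℂ H] [CompleteSpace H]
    [TopologicalSpace.SeparableSpace H]
    [MeasurableSpace Y] (ν : Measure Y) [SigmaFinite ν]
    [Countable I] [MeasurableSpace I] [DiscreteMeasurableSpace I]
    (g : Y → Lp ℂ ∞ μ) (hg : MultInv.IsParsevalDetermining μ ν g) :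
    -- frames correspond to locally invertible, integrable MI operators
    (∃ F : Quotient (MultInv.frameSetoid H I ν g) ≃ MultInv.GramOperators H I μ,
      ∀ (φ : MultInv.FrameGenerators H I ν g) (T : MultInv.GramOperators H I μ)
        (R : X → MultInv.Ell2 I →L[ℂ] MultInv.Ell2 I), MultInv.IsDirectIntegral R T.1 →
        (F (Quotient.mk _ φ) = T ↔
          ∀ᵐ x ∂μ, MultInv.IsGramian (fun i => φ.1 i x) (R x))) ∧
    -- Parseval frames correspond to integrable range functions
    (∃ F : Quotient (MultInv.parsevalSetoid H I ν g) ≃ Quotient (MultInv.rangeSetoid H I μ),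
      ∀ (φ : MultInv.ParsevalGenerators H I ν g) (J : MultInv.RangeFunctions H I μ),
        (F (Quotient.mk _ φ) = Quotient.mk _ J ↔
          ∀ᵐ x ∂μ, MultInv.IsGramian (fun i => φ.1 i x) (MultInv.rangeProj J.1 x))) := by
  have hgram : ∀ {φ ψ : I → Lp H 2 μ} {R R' : X → Ell2 I →L[ℂ] Ell2 I},
      (∀ᵐ x ∂μ, IsGramian (fun i => φ i x) (R x)) → (∀ᵐ x ∂μ, IsGramian (fun i => ψ i x) (R' x)) →
      (UnitarilyEquivalent (multSystem g φ) (multSystem g ψ) ↔ ∀ᵐ x ∂μ, R x = R' x) := by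
    intro φ ψ R R' h h'
    rw [hg.unitarilyEquivalent_iff]
    refine eventually_congr ?_
    filter_upwards [h, h'] with x h1 h2
    constructor
    · exact fun h3 => ext_inner_delta fun i j => by rw [h1.inner_delta, h2.inner_delta, h3]
    · exact fun h3 i j => by rw [← h1.inner_delta, ← h2.inner_delta, h3]
  constructor
  · refine (exists_equiv_of_rel (frameSetoid H I ν g)
      (fun φ (T : GramOperators H I μ) => ∃ R, IsDirectIntegral R T.1 ∧
        ∀ᵐ x ∂μ, IsGramian (fun i => φ.1 i x) (R x)) ?_ ?_ ?_).imp fun F hF => ?_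
    · rintro ⟨φ, A, B, h⟩
      obtain ⟨T, R, hT⟩ := exists_fibreAnalysis_of_isFrame hg h
      have hpos : (T ∘L ContinuousLinearMap.adjoint T).IsPositive :=
        ContinuousLinearMap.isPositive_self_comp_adjoint T
      refine ⟨⟨T ∘L ContinuousLinearMap.adjoint T, hT.directIntegral.isMI, ⟨hpos, A, h.lower_pos, ?_⟩,
        R, hT.directIntegral, isIntegrableField_of_gram (hT.gramian.mono fun _ hx => hx.inner_delta),
        hT.gramian.mono fun _ hx => hx.dimension_range_le⟩, R, hT.directIntegral, hT.gramian⟩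
      exact (spectrum_subset_iff hpos h.lower_pos).2
        ((hT.isFrame_iff hg h.lower_pos h.upper_pos).1 h).2
    · rintro ⟨G, -, ⟨hpos, δ, hδ, hsp⟩, R, hR, hint, hdim⟩
      obtain ⟨φ, T, R', hT, rfl, hφ⟩ := exists_fibreAnalysis_of_positive hpos hR hint hdim
      -- The spectral gap serves as lower frame bound; adding 1 keeps the upper bound positive when
      -- `T = 0`.
      have hB : 0 < ‖T‖ ^ 2 + 1 := by positivity
      refine ⟨⟨φ, δ, ‖T‖ ^ 2 + 1, (hT.isFrame_iff hg hδ hB).2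
        ⟨fun v => ?_, (spectrum_subset_iff hpos hδ).1 hsp⟩⟩, R, hR, hφ⟩
      have h1 := pow_le_pow_left₀ (norm_nonneg _) (T.le_opNorm v) 2
      rw [mul_pow] at h1
      nlinarith [sq_nonneg ‖v‖]
    · rintro φ ψ T T' ⟨R, hR, h⟩ ⟨R', hR', h'⟩
      refine (hgram h h').trans ⟨fun h3 => ?_, fun h3 => ?_⟩
      · exact Subtype.ext (directIntegral_eq_of_ae_eq hR.apply_ae hR'.apply_ae h3)
      · subst h3
        exact ae_eq_of_directIntegral hR.apply_ae hR'.apply_ae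
    · refine fun φ T R hR => (hF φ T).trans ⟨?_, fun h => ⟨R, hR, h⟩⟩
      rintro ⟨R', hR', h⟩
      filter_upwards [h, ae_eq_of_directIntegral hR.apply_ae hR'.apply_ae] with x h1 h2
      rwa [h2]
  · have hproj : ∀ J J' : RangeFunctions (X := X) H I μ,
        (∀ᵐ x ∂μ, rangeProj J.1 x = rangeProj J'.1 x) ↔
          Quotient.mk (rangeSetoid H I μ) J = Quotient.mk (rangeSetoid H I μ) J' := by
      intro J J'
      rw [Quotient.eq]
      refine eventually_congr (Eventually.of_forall fun x => ?_)
      rw [rangeProj, rangeProj, Submodule.starProjection_inj]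
      exact ClosedSubmodule.toSubmodule_injective.eq_iff
    refine (exists_equiv_of_rel (parsevalSetoid H I ν g)
      (fun φ (q : Quotient (rangeSetoid (X := X) H I μ)) => ∃ J, Quotient.mk _ J = q ∧
        ∀ᵐ x ∂μ, IsGramian (fun i => φ.1 i x) (rangeProj J.1 x)) ?_ ?_ ?_).imp fun F hF => ?_
    · rintro ⟨φ, h⟩
      obtain ⟨T, R, hT⟩ := exists_fibreAnalysis_of_isFrame hg h
      have hidem := (norm_sq_le_and_iff T).1 ((hT.isFrame_iff hg one_pos one_pos).1 h)
      -- Both fields represent the idempotent `T T*`, and the field of a direct integral is unique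
      -- almost everywhere.
      have hRR : ∀ᵐ x ∂μ, R x * R x = R x := by
        refine ae_eq_of_directIntegral (fun f => ?_) hT.directIntegral.apply_ae
        filter_upwards [hT.directIntegral.apply_ae f,
          hT.directIntegral.apply_ae ((T ∘L ContinuousLinearMap.adjoint T) f)] with x h1 h2
        rw [h1] at h2
        rw [_root_.mul_apply_eq_comp, ← h2]
        exact congrArg (fun Q : Lp (Ell2 I) 2 μ →L[ℂ] Lp (Ell2 I) 2 μ => Q f x) hidem.symm
      have hproj : ∀ᵐ x ∂μ, rangeProj (fun x => fixedSpace (R x)) x = R x := by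
        filter_upwards [hRR, hT.gramian] with x h1 h2
        exact starProjection_fixedSpace (isSelfAdjoint_of_isGramian h2) h1
      have hgr : ∀ᵐ x ∂μ, IsGramian (fun i => φ i x) (rangeProj (fun x => fixedSpace (R x)) x) := by
        filter_upwards [hproj, hT.gramian] with x h1 h2
        rwa [h1]
      refine ⟨_, ⟨fun x => fixedSpace (R x), fun u v => ?_, isIntegrableField_of_gram
        (hgr.mono fun _ hx => hx.inner_delta), ?_⟩, rfl, hgr⟩
      -- Off a null set the projection onto the fixed space is `R x`; completeness of `μ` absorbs
      -- the exceptional set.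
      · refine NullMeasurable.measurable_of_complete (μ := μ) (AEMeasurable.nullMeasurable ?_)
        refine (hT.directIntegral.measurable u v).aemeasurable.congr ?_
        filter_upwards [hproj] with x hx
        rw [hx]
      · filter_upwards [hgr] with x hx
        exact (dimension_range_starProjection _).symm.le.trans hx.dimension_range_le
    · intro q
      induction q using Quotient.ind with | _ J
      obtain ⟨J, hJm, hint, hdim⟩ := J
      have hb : ∃ C : ℝ, ∀ᵐ x ∂μ, ‖rangeProj J x‖ ≤ C :=
        ⟨1, Eventually.of_forall fun _ => Submodule.starProjection_norm_le _⟩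
      have := separableSpace_ell2 (I := I)
      obtain ⟨G, hG⟩ := exists_directIntegral hJm hb
      have hsa : IsSelfAdjoint G := by
        refine (adjoint_directIntegral hG fun f => ?_).symm
        filter_upwards [hG f] with x hx
        have hs : IsSelfAdjoint (rangeProj J x) := isSelfAdjoint_starProjection (J x).toSubmodule
        rw [hx, hs.adjoint_eq]
      have hidem : G * G = G := by
        refine directIntegral_eq_of_ae_eq (fun f => ?_) hG
          (Eventually.of_forall fun x => (J x).toSubmodule.isIdempotentElem_starProjection)
        filter_upwards [hG f, hG (G f)] with x h1 h2
        rw [h1] at h2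
        exact h2
      have hpos : G.IsPositive :=
        ((ContinuousLinearMap.IsIdempotentElem.isPositive_iff_isSelfAdjoint hidem).2 hsa)
      obtain ⟨φ, T, R', hT, hTG, hφ⟩ := exists_fibreAnalysis_of_positive (H := H) hpos
        ⟨hJm, hb, hG⟩ hint (hdim.mono fun _ hx =>
          (dimension_range_starProjection _).le.trans hx)
      refine ⟨⟨φ, (hT.isFrame_iff hg one_pos one_pos).2 ((norm_sq_le_and_iff T).2 ?_)⟩, _, rfl, hφ⟩
      rw [hTG, hidem]
    · rintro φ ψ q q' ⟨J, rfl, h⟩ ⟨J', rfl, h'⟩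
      exact (hgram h h').trans (hproj J J')
    · refine fun φ J => (hF φ _).trans ⟨?_, fun h => ⟨J, rfl, h⟩⟩
      rintro ⟨J', hJ', h⟩
      filter_upwards [h, (hproj J' J).2 hJ'] with x h1 h2
      rwa [← h2]
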